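/- Let $0<|e|<m$, $r_\pm=m\pm\sqrt{m^2-e^2}$, and $f(r)=1-\frac{2m}{r}+\frac{e^2}{r^2}$, and consider the sub-extremal Reissner–Nordström metric $g=-f\,dt^2+f^{-1}dr^2+r^2d\Omega$ of mass $m$ and charge $e$. For a time-oriented spacetime $(M,g)$ let $I^+(x)$ be the set of events reached from $x$ by a piecewise smooth future-directed timelike curve in $M$, and let $\operatorname{vol}_g$ be the volume measure. $(M,g)$ is called (future) volume incomplete if for every $\varepsilon>0$ there is $x\in M$ with $\operatorname{vol}_g(I^+(x))<\varepsilon$, and (future) volume complete otherwise. The maximal analytic extension is the spacetime obtained by stacking, alternately and periodically for all integers, the Kruskal charts at $r=r_+$ (covering $r>r_-$) and at $r=r_-$ (covering $0<r<r_+$), each chart being glued along its future region $\{r_-<r<r_+\}$ to the past region $\{r_-<r<r_+\}$ of the next chart. 1. Consider the region $\{r>r_-\}$, either with one asymptotic end ($\mathbb R\times(r_-,\infty)\times S^2$: an exterior region, its future event horizon and the black-hole region) or with two asymptotic ends (a full Kruskal chart at $r_+$, i.e. a connected component of $\{r>r_-\}$ in the maximal analytic extension). This region, as a spacetime in itself,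 is volume incomplete, and $\operatorname{vol}_g(I^+(p))<\infty$ for every point $p$ of the black-hole region $\{r_-<r<r_+\}$ (the future one of the two such regions in the two-ended case), $I^+(p)$ being taken in the region $\{r>r_-\}$. 2. The maximal analytic extension is volume complete; in fact $\operatorname{vol}_g(I^+(p))=\infty$ for every point $p$ in it. -/

import Mathlib

open Set MeasureTheory
open scoped ContDiff

noncomputable section

/-- Future volume incompleteness, for a set `M` of events with chronological futures `I x` and
volume measure `vol`: events with futures of arbitrarily small volume exist. -/
def FutureVolumeIncomplete {M : Type*} [MeasurableSpace M] (I : M → Set M) (vol : Measure M) :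
    Prop :=
  ∀ ε : ℝ, 0 < ε → ∃ x : M, vol (I x) < ENNReal.ofReal ε

/-- Future volume completeness is the negation of future volume incompleteness. -/
def FutureVolumeComplete {M : Type*} [MeasurableSpace M] (I : M → Set M) (vol : Measure M) :
    Prop :=
  ¬ FutureVolumeIncomplete I vol

/-- Euclidean three-space. -/
abbrev E3 : Type := EuclideanSpace ℝ (Fin 3)

/-- The unit two-sphere in Euclidean three-space. -/
abbrev S2 : Type := Metric.sphere (0 : E3) 1

/-- The data of a spherically symmetric Lorentzian metric
`g = - F(u,v) du dv + r(u,v)² dΩ` on `Q × S²`, where `Q` is a region of the `(u,v)`-plane and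
`dΩ` is the round metric of the unit sphere. It is time-oriented by `∂_u + ∂_v`. -/
structure DoubleNull where
  /-- the region of the `(u,v)`-plane -/
  Q : Set (ℝ × ℝ)
  /-- the coefficient of `- du dv` -/
  F : ℝ × ℝ → ℝ
  /-- the area radius -/
  r : ℝ × ℝ → ℝ

namespace DoubleNull

/-- The events of the spacetime: `Q × S²`. -/
abbrev Event (S : DoubleNull) : Type := S.Q × S2

/-- `g(X,X)` for the tangent vector `X = (a, w)` over `c ∈ Q`. Here `a = (du(X), dv(X))`, and
`w ∈ ℝ³` is the component of `X` tangent to the unit sphere. -/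
def normSq (S : DoubleNull) (c a : ℝ × ℝ) (w : E3) : ℝ :=
  -(S.F c) * (a.1 * a.2) + S.r c ^ 2 * ‖w‖ ^ 2

/-- There is a smooth future-directed timelike curve `s ↦ (c s, y s)`, `s ∈ [0,1]`, from `p`
to `q`. A timelike vector `X` has `du(X) dv(X) > 0`, and it is future-directed, that is
`g(∂_u + ∂_v, X) = - F (du(X) + dv(X)) / 2 < 0`, exactly if `du(X)` and `dv(X)` are positive. -/
def TimelikeCurve (S : DoubleNull) (p q : S.Event) : Prop :=
  ∃ (c : ℝ → ℝ × ℝ) (y : ℝ → E3),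
    ContDiffOn ℝ ∞ c (Icc 0 1) ∧ ContDiffOn ℝ ∞ y (Icc 0 1) ∧
    c 0 = p.1 ∧ y 0 = p.2 ∧ c 1 = q.1 ∧ y 1 = q.2 ∧
    ∀ s ∈ Icc (0 : ℝ) 1, c s ∈ S.Q ∧ y s ∈ Metric.sphere (0 : E3) 1 ∧
      S.normSq (c s) (derivWithin c (Icc 0 1) s) (derivWithin y (Icc 0 1) s) < 0 ∧
      0 < (derivWithin c (Icc 0 1) s).1 ∧ 0 < (derivWithin c (Icc 0 1) s).2

/-- The chronological future `I⁺(p)`: the events that are reached from `p` by a piecewise smooth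
future-directed timelike curve, i.e. a finite nonempty chain of smooth ones. -/
def chronFuture (S : DoubleNull) (p : S.Event) : Set S.Event :=
  {q | Relation.TransGen S.TimelikeCurve p q}

/-- The volume measure `√|det g| du dv dσ = (F / 2) r² du dv dσ`, where `σ` is the area measure
of the unit sphere. -/
def vol (S : DoubleNull) : Measure S.Event :=
  (((volume : Measure (ℝ × ℝ)).comap (Subtype.val : S.Q → ℝ × ℝ)).prod (volume : Measure E3).toSphere).withDensity
    fun x => ENNReal.ofReal (S.F x.1 / 2 * S.r x.1 ^ 2)

/-- The open submanifold over the events with `(u,v) ∈ D`. -/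
def restrict (S : DoubleNull) (D : Set (ℝ × ℝ)) : DoubleNull where
  Q := S.Q ∩ D
  F := S.F
  r := S.r

end DoubleNull

/-! Reissner–Nordström spacetime of mass `m` and charge `e`, with `0 < |e| < m`. -/

namespace RN

/-- The coefficient `f(r)` of the metric `- f dt² + f⁻¹ dr² + r² dΩ`. -/
def f (m e r : ℝ) : ℝ := 1 - 2 * m / r + e ^ 2 / r ^ 2

/-- The larger zero `r₊` of `f`. -/
def rPlus (m e : ℝ) : ℝ := m + √(m ^ 2 - e ^ 2)

/-- The smaller zero `r₋` of `f`. -/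
def rMinus (m e : ℝ) : ℝ := m - √(m ^ 2 - e ^ 2)

/-- The surface gravity `κ₊ = f'(r₊) / 2`. -/
def kPlus (m e : ℝ) : ℝ := (rPlus m e - rMinus m e) / (2 * rPlus m e ^ 2)

/-- The surface gravity `κ₋ = - f'(r₋) / 2`. -/
def kMinus (m e : ℝ) : ℝ := (rPlus m e - rMinus m e) / (2 * rMinus m e ^ 2)

/-! ### Kruskal charts

A tortoise coordinate, with `dr* / dr = 1 / f`, is
`r* = r + log |r - r₊| / (2 κ₊) - log |r - r₋| / (2 κ₋)`.
Kruskal coordinates at `r₊` have `|U| = exp (κ₊ (r* - t))`, `|V| = exp (κ₊ (r* + t))`. They cover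
`r > r₋`, with `U V = outerUV r`, and `g = - outerF r dU dV + r² dΩ`. Kruskal coordinates at `r₋`
have `|U| = exp (-κ₋ (r* - t))`, `|V| = exp (-κ₋ (r* + t))`. They cover `0 < r < r₊`, with
`U V = innerUV r`, and `g = - innerF r dU dV + r² dΩ`. -/

/-- `U V` in the chart at `r₊`: a strictly decreasing bijection from `(r₋, ∞)` to `ℝ`. -/
def outerUV (m e r : ℝ) : ℝ :=
  (rPlus m e - r) * (r - rMinus m e) ^ (-(kPlus m e / kMinus m e)) * Real.exp (2 * kPlus m e * r)

/-- The area radius in the chart at `r₊`, as a function of `x = U V`. -/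
def outerR (m e x : ℝ) : ℝ := Function.invFunOn (outerUV m e) (Ioi (rMinus m e)) x

/-- The coefficient of `- dU dV` in the chart at `r₊`. -/
def outerF (m e r : ℝ) : ℝ :=
  (r - rMinus m e) ^ (1 + kPlus m e / kMinus m e) * Real.exp (-(2 * kPlus m e * r)) /
    (kPlus m e ^ 2 * r ^ 2)

/-- `U V` in the chart at `r₋`: a strictly increasing bijection from `(0, r₊)` to
`(innerUV 0, ∞)`. The end `innerUV 0` is the curvature singularity. -/
def innerUV (m e r : ℝ) : ℝ :=
  (r - rMinus m e) * (rPlus m e - r) ^ (-(kMinus m e / kPlus m e)) *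
    Real.exp (-(2 * kMinus m e * r))

/-- The area radius in the chart at `r₋`, as a function of `x = U V`. -/
def innerR (m e x : ℝ) : ℝ := Function.invFunOn (innerUV m e) (Ioo 0 (rPlus m e)) x

/-- The coefficient of `- dU dV` in the chart at `r₋`. -/
def innerF (m e r : ℝ) : ℝ :=
  (rPlus m e - r) ^ (1 + kMinus m e / kPlus m e) * Real.exp (2 * kMinus m e * r) /
    (kMinus m e ^ 2 * r ^ 2)

/-! ### The stack of Kruskal charts

Charts at `r₊` and at `r₋` are stacked alternately: the future quadrant `U, V > 0` of each chart
is identified with the past quadrant `U, V < 0` of the next one by `U' = - U ^ (-κ'/κ)`,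
`V' = - V ^ (-κ'/κ)`, where `κ`, `κ'` are the surface gravities that belong to the two charts.
Global analytic null coordinates `(u,v)` on the stack are obtained from `U = kruskal a (u - k)`,
`V = kruskal a (v - k)`, `a = κ/κ'`, in the `k`-th chart. It is the square
`|u - k| < 1`, `|v - k| < 1`, and it is a chart at `r₊` for even `k`, at `r₋` for odd `k`. -/

/-- The increasing analytic parametrization of `ℝ` by `(-1, 1)` for a Kruskal coordinate. -/
def kruskal (a w : ℝ) : ℝ := Real.sin (Real.pi * w / 2) * Real.cos (Real.pi * w / 2) ^ (-a)

/-! ### Consistency of the charts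

In each chart `U V` times the coefficient of `- dU dV` is `- f / κ²`, which says that the chart's
metric is `- f dt² + f⁻¹ dr² + r² dΩ`. On the overlap of two consecutive charts, the
parametrizations `kruskal` and the functions `U V` of `r` satisfy the gluing relations. -/

theorem rMinus_pos {m e : ℝ} (he : 0 < |e|) (hem : |e| < m) : 0 < rMinus m e := by
  have h2 : e ^ 2 < m ^ 2 := sq_lt_sq.2 (by rwa [abs_of_pos (he.trans hem)])
  have h0 : 0 < e ^ 2 := by rw [← sq_abs]; positivity
  have : √(m ^ 2 - e ^ 2) < m := (Real.sqrt_lt' (he.trans hem)).2 (by linarith)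
  unfold rMinus
  linarith

theorem rMinus_lt_rPlus {m e : ℝ} (hem : |e| < m) : rMinus m e < rPlus m e := by
  have h2 : e ^ 2 < m ^ 2 :=
    sq_lt_sq.2 (by rwa [abs_of_pos ((abs_nonneg e).trans_lt hem)])
  have : 0 < √(m ^ 2 - e ^ 2) := Real.sqrt_pos.2 (by linarith)
  unfold rMinus rPlus
  linarith

theorem f_eq {m e r : ℝ} (hem : |e| < m) (hr : r ≠ 0) :
    f m e r = (r - rPlus m e) * (r - rMinus m e) / r ^ 2 := by
  have h2 : e ^ 2 < m ^ 2 :=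
    sq_lt_sq.2 (by rwa [abs_of_pos ((abs_nonneg e).trans_lt hem)])
  have hs : √(m ^ 2 - e ^ 2) ^ 2 = m ^ 2 - e ^ 2 := Real.sq_sqrt (by linarith)
  unfold f rPlus rMinus
  field_simp
  linear_combination hs

theorem outerF_mul_outerUV {m e r : ℝ} (he : 0 < |e|) (hem : |e| < m) (hr : rMinus m e < r) :
    outerF m e r * outerUV m e r = -f m e r / kPlus m e ^ 2 := by
  have hm := rMinus_pos he hem
  have hlt := rMinus_lt_rPlus hem
  have hk : kPlus m e ≠ 0 := by
    have : 0 < rPlus m e := hm.trans hlt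
    have : 0 < rPlus m e - rMinus m e := by linarith
    unfold kPlus
    positivity
  have hr0 : r ≠ 0 := (hm.trans hr).ne'
  have hb : 0 < r - rMinus m e := by linarith
  have h1 : (r - rMinus m e) ^ (1 + kPlus m e / kMinus m e) *
      (r - rMinus m e) ^ (-(kPlus m e / kMinus m e)) = r - rMinus m e := by
    rw [← Real.rpow_add hb]; simp
  have h2 : Real.exp (-(2 * kPlus m e * r)) * Real.exp (2 * kPlus m e * r) = 1 := by
    rw [← Real.exp_add]; simp
  rw [f_eq hem hr0]
  unfold outerF outerUV
  calc _ = ((r - rMinus m e) ^ (1 + kPlus m e / kMinus m e) *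
      (r - rMinus m e) ^ (-(kPlus m e / kMinus m e))) *
      (Real.exp (-(2 * kPlus m e * r)) * Real.exp (2 * kPlus m e * r)) *
      (rPlus m e - r) / (kPlus m e ^ 2 * r ^ 2) := by ring
    _ = _ := by rw [h1, h2]; field_simp; ring

theorem innerF_mul_innerUV {m e r : ℝ} (he : 0 < |e|) (hem : |e| < m) (hr0 : 0 < r)
    (hr : r < rPlus m e) : innerF m e r * innerUV m e r = -f m e r / kMinus m e ^ 2 := by
  have hm := rMinus_pos he hem
  have hlt := rMinus_lt_rPlus hem
  have hk : kMinus m e ≠ 0 := by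
    have : 0 < rPlus m e - rMinus m e := by linarith
    unfold kMinus
    positivity
  have hr0 : r ≠ 0 := hr0.ne'
  have hb : 0 < rPlus m e - r := by linarith
  have h1 : (rPlus m e - r) ^ (1 + kMinus m e / kPlus m e) *
      (rPlus m e - r) ^ (-(kMinus m e / kPlus m e)) = rPlus m e - r := by
    rw [← Real.rpow_add hb]; simp
  have h2 : Real.exp (2 * kMinus m e * r) * Real.exp (-(2 * kMinus m e * r)) = 1 := by
    rw [← Real.exp_add]; simp
  rw [f_eq hem hr0]
  unfold innerF innerUV
  calc _ = ((rPlus m e - r) ^ (1 + kMinus m e / kPlus m e) *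
      (rPlus m e - r) ^ (-(kMinus m e / kPlus m e))) *
      (Real.exp (2 * kMinus m e * r) * Real.exp (-(2 * kMinus m e * r))) *
      (r - rMinus m e) / (kMinus m e ^ 2 * r ^ 2) := by ring
    _ = _ := by rw [h1, h2]; field_simp; ring

theorem kruskal_glue {a b w : ℝ} (hab : a * b = 1) (h0 : 0 < w) (h1 : w < 1) :
    kruskal b (w - 1) = -kruskal a w ^ (-b) := by
  have hpi := Real.pi_pos
  have hs : 0 < Real.sin (Real.pi * w / 2) :=
    Real.sin_pos_of_pos_of_lt_pi (by positivity) (by nlinarith)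
  have hc : 0 < Real.cos (Real.pi * w / 2) :=
    Real.cos_pos_of_mem_Ioo ⟨by nlinarith, by nlinarith⟩
  have e1 : Real.pi * (w - 1) / 2 = Real.pi * w / 2 - Real.pi / 2 := by ring
  unfold kruskal
  rw [e1, Real.sin_sub_pi_div_two, Real.cos_sub_pi_div_two,
    Real.mul_rpow hs.le (Real.rpow_nonneg hc.le _), ← Real.rpow_mul hc.le, neg_mul_neg, hab,
    Real.rpow_one]
  ring

theorem UV_glue {m e r : ℝ} (he : 0 < |e|) (hem : |e| < m) (h0 : rMinus m e < r)
    (h1 : r < rPlus m e) :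
    innerUV m e r = outerUV m e r ^ (-(kMinus m e / kPlus m e)) := by
  have hm := rMinus_pos he hem
  have hlt := rMinus_lt_rPlus hem
  have hd : 0 < rPlus m e - rMinus m e := by linarith
  have hp : 0 < rPlus m e := hm.trans hlt
  have hk : kPlus m e ≠ 0 := by unfold kPlus; positivity
  have hk' : kMinus m e ≠ 0 := by unfold kMinus; positivity
  have ha : 0 < rPlus m e - r := by linarith
  have hb : 0 < r - rMinus m e := by linarith
  have e1 : -(kPlus m e / kMinus m e) * -(kMinus m e / kPlus m e) = 1 := by field_simp
  have e2 : 2 * kPlus m e * r * -(kMinus m e / kPlus m e) = -(2 * kMinus m e * r) := by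
    field_simp
  unfold innerUV outerUV
  rw [Real.mul_rpow (by positivity) (Real.exp_pos _).le, Real.mul_rpow ha.le (by positivity),
    ← Real.rpow_mul hb.le, ← Real.exp_mul, e1, e2, Real.rpow_one]
  ring

/-- The open square with centre `(k, k)` and sides of length two. -/
def square (k : ℤ) : Set (ℝ × ℝ) := {x | |x.1 - k| < 1 ∧ |x.2 - k| < 1}

/-- `U V` in the `k`-th chart, if that is a chart at `r₊`. -/
def outerProd (m e : ℝ) (k : ℤ) (x : ℝ × ℝ) : ℝ :=
  kruskal (kPlus m e / kMinus m e) (x.1 - k) * kruskal (kPlus m e / kMinus m e) (x.2 - k)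

/-- `U V` in the `k`-th chart, if that is a chart at `r₋`. -/
def innerProd (m e : ℝ) (k : ℤ) (x : ℝ × ℝ) : ℝ :=
  kruskal (kMinus m e / kPlus m e) (x.1 - k) * kruskal (kMinus m e / kPlus m e) (x.2 - k)

/-- The chart at `r₋` with centre `(k, k)`: the part `r > 0` of the square. -/
def innerChart (m e : ℝ) (k : ℤ) : Set (ℝ × ℝ) :=
  {x | x ∈ square k ∧ innerUV m e 0 < innerProd m e k x}

/-- The even integer `k` for which `|u - k| < 1`, if `u` is not an odd integer. -/
def evenIndex (u : ℝ) : ℤ := 2 * round (u / 2)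

/-- The odd integer `k` for which `|u - k| < 1`, if `u` is not an even integer. -/
def oddIndex (u : ℝ) : ℤ := 2 * ⌊u / 2⌋ + 1

open Classical in
/-- The area radius on the stack. -/
def radius (m e : ℝ) (x : ℝ × ℝ) : ℝ :=
  if x ∈ square (evenIndex x.1) then outerR m e (outerProd m e (evenIndex x.1) x)
  else innerR m e (innerProd m e (oddIndex x.1) x)

open Classical in
/-- The coefficient of `- du dv` on the stack: the chart's coefficient of `- dU dV` times
`dU/du` times `dV/dv`. -/
def coeff (m e : ℝ) (x : ℝ × ℝ) : ℝ :=
  if x ∈ square (evenIndex x.1) then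
    outerF m e (outerR m e (outerProd m e (evenIndex x.1) x)) *
      deriv (kruskal (kPlus m e / kMinus m e)) (x.1 - evenIndex x.1) *
      deriv (kruskal (kPlus m e / kMinus m e)) (x.2 - evenIndex x.1)
  else
    innerF m e (innerR m e (innerProd m e (oddIndex x.1) x)) *
      deriv (kruskal (kMinus m e / kPlus m e)) (x.1 - oddIndex x.1) *
      deriv (kruskal (kMinus m e / kPlus m e)) (x.2 - oddIndex x.1)

/-- The maximal analytic extension of Reissner–Nordström spacetime. -/
def maximalExtension (m e : ℝ) : DoubleNull where
  Q := {x | ∃ n : ℤ, x ∈ square (2 * n) ∨ x ∈ innerChart m e (2 * n + 1)}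
  F := coeff m e
  r := radius m e

/-- The region `{r > r₋}` with one asymptotic end: one exterior region, its future event horizon
and the black-hole region. It is covered by ingoing Eddington–Finkelstein coordinates, which
identify it with `ℝ × (r₋, ∞) × S²`. -/
def oneEndedRegion (m e : ℝ) : DoubleNull :=
  (maximalExtension m e).restrict {x | rMinus m e < radius m e x ∧ x ∈ square 0 ∧ 0 < x.2}

/-- The region `{r > r₋}` with two asymptotic ends, i.e. one connected component of `{r > r₋}` in
the maximal analytic extension: two exterior regions, a black-hole region and a white-hole region,
with the horizons `{r = r₊}` between them. -/
def twoEndedRegion (m e : ℝ) : DoubleNull :=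
  (maximalExtension m e).restrict {x | rMinus m e < radius m e x ∧ x ∈ square 0}

end RN

end

noncomputable section

open Filter Topology Metric

namespace RN

/-! ### The parametrization `kruskal` -/

/-! Both halves rest on the size of the volume density `F r² / 2` in the compactified null
coordinates `(u,v)`: it is bounded towards the Cauchy horizon `r = r₋` and blows up towards null
infinity.

Incompleteness. Put `a = κ₊/κ₋`. Near `r₋` the product `U V` grows like `(r - r₋)^(-a)`, and `outerF
r²` is of the order of `(r - r₋)^(1 + a)`, hence at most a constant times `(U V)^(-(1 + 1/a))`. The
derivative of `kruskal a` is at most a constant times `kruskal a ^ (1 + 1/a)` away from zero. The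
powers cancel (`exists_density_le`), so the density is bounded on `u, v ≥ w₀ > 0`. Both null
coordinates increase along a timelike curve, so inside the square the future of `(u,v)` lies over
the rectangle `(u,1) × (v,1)`. Its volume is therefore finite, and it tends to zero as the point
moves up the diagonal to the corner `(1,1)`.

Completeness. In the stack every event can reach the diagonal `u = v` far up
(`eventually_diag_mem_chronFuture`). From the centre of a square at `r₊` a curve can turn through a
small angle (`exists_timelikeCurve_rotation`) and then continue up the diagonal into the white-hole
quadrant of the next square at `r₊`. From there it reaches, for an open set of directions, a part of
an exterior region adjacent to future null infinity. There `outerF r² |U V| = (r - r₊)(r - r₋)/κ₊²`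
tends to infinity, while `(dV/dv)/V` is at least a constant over the distance to the edge. Thin
strips along the edge thus have arbitrarily large volume (`exists_le_density`), and every future has
infinite volume. -/

theorem cos_pos_of_abs_lt_one {w : ℝ} (hw : |w| < 1) : 0 < Real.cos (Real.pi * w / 2) := by
  have hpi := Real.pi_pos
  obtain ⟨h1, h2⟩ := abs_lt.1 hw
  exact Real.cos_pos_of_mem_Ioo ⟨by nlinarith, by nlinarith⟩

theorem sin_pos_of_pos_of_lt_one {w : ℝ} (h0 : 0 < w) (h1 : w < 1) :
    0 < Real.sin (Real.pi * w / 2) := by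
  have hpi := Real.pi_pos
  exact Real.sin_pos_of_pos_of_lt_pi (by positivity) (by nlinarith)

theorem hasDerivAt_kruskal (a : ℝ) {w : ℝ} (hw : |w| < 1) :
    HasDerivAt (kruskal a) (Real.pi / 2 * (Real.cos (Real.pi * w / 2) ^ 2 +
      a * Real.sin (Real.pi * w / 2) ^ 2) * Real.cos (Real.pi * w / 2) ^ (-a - 1)) w := by
  have hc := cos_pos_of_abs_lt_one hw
  have h : HasDerivAt (fun w : ℝ => Real.pi * w / 2) (Real.pi / 2) w := by
    simpa using ((hasDerivAt_id w).const_mul Real.pi).div_const 2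
  have h2 := h.sin.mul (h.cos.rpow_const (p := -a) (Or.inl hc.ne'))
  have e1 : Real.cos (Real.pi * w / 2) ^ (-a) =
      Real.cos (Real.pi * w / 2) ^ (-a - 1) * Real.cos (Real.pi * w / 2) := by
    rw [← Real.rpow_add_one hc.ne']; ring_nf
  refine (h2.congr_deriv ?_)
  rw [e1]
  ring

theorem deriv_kruskal (a : ℝ) {w : ℝ} (hw : |w| < 1) :
    deriv (kruskal a) w = Real.pi / 2 * (Real.cos (Real.pi * w / 2) ^ 2 +
      a * Real.sin (Real.pi * w / 2) ^ 2) * Real.cos (Real.pi * w / 2) ^ (-a - 1) :=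
  (hasDerivAt_kruskal a hw).deriv

theorem min_le_cos_sq_add {a : ℝ} (x : ℝ) : min 1 a ≤ Real.cos x ^ 2 + a * Real.sin x ^ 2 := by
  have h := Real.sin_sq_add_cos_sq x
  rcases min_cases 1 a with ⟨h1, h2⟩ | ⟨h1, h2⟩ <;> rw [h1] <;>
    nlinarith [sq_nonneg (Real.cos x), sq_nonneg (Real.sin x)]

theorem cos_sq_add_le {a : ℝ} (ha : 0 < a) (x : ℝ) :
    Real.cos x ^ 2 + a * Real.sin x ^ 2 ≤ 1 + a := by
  have h := Real.sin_sq_add_cos_sq x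
  nlinarith [sq_nonneg (Real.cos x), sq_nonneg (Real.sin x)]

theorem le_deriv_kruskal {a : ℝ} (ha : 0 < a) {w : ℝ} (hw : |w| < 1) :
    Real.pi / 2 * min 1 a ≤ deriv (kruskal a) w := by
  rw [deriv_kruskal a hw]
  have hc := cos_pos_of_abs_lt_one hw
  have h1 : 1 ≤ Real.cos (Real.pi * w / 2) ^ (-a - 1) :=
    Real.one_le_rpow_of_pos_of_le_one_of_nonpos hc (Real.cos_le_one _) (by linarith)
  have h2 := min_le_cos_sq_add (a := a) (Real.pi * w / 2)
  have h3 : 0 < min 1 a := lt_min one_pos ha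
  have hpi := Real.pi_pos
  calc Real.pi / 2 * min 1 a = Real.pi / 2 * min 1 a * 1 := by ring
    _ ≤ _ := by gcongr

theorem deriv_kruskal_pos {a : ℝ} (ha : 0 < a) {w : ℝ} (hw : |w| < 1) :
    0 < deriv (kruskal a) w :=
  lt_of_lt_of_le (by have := Real.pi_pos; have := lt_min one_pos ha; positivity)
    (le_deriv_kruskal ha hw)

theorem continuousOn_kruskal (a : ℝ) : ContinuousOn (kruskal a) (Ioo (-1) 1) :=
  fun _ hw => (hasDerivAt_kruskal a (abs_lt.2 hw)).continuousAt.continuousWithinAt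

theorem strictMonoOn_kruskal {a : ℝ} (ha : 0 < a) : StrictMonoOn (kruskal a) (Ioo (-1) 1) := by
  refine strictMonoOn_of_deriv_pos (convex_Ioo _ _) (continuousOn_kruskal a) fun w hw => ?_
  rw [interior_Ioo] at hw
  exact deriv_kruskal_pos ha (abs_lt.2 hw)

@[simp] theorem kruskal_zero (a : ℝ) : kruskal a 0 = 0 := by simp [kruskal]

theorem kruskal_pos_iff {a : ℝ} (ha : 0 < a) {w : ℝ} (hw : |w| < 1) : 0 < kruskal a w ↔ 0 < w := by
  simpa using (strictMonoOn_kruskal ha).lt_iff_lt (a := 0) (b := w) (by simp) (abs_lt.1 hw)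

theorem kruskal_neg_iff {a : ℝ} (ha : 0 < a) {w : ℝ} (hw : |w| < 1) : kruskal a w < 0 ↔ w < 0 := by
  simpa using (strictMonoOn_kruskal ha).lt_iff_lt (a := w) (b := 0) (abs_lt.1 hw) (by simp)

theorem tendsto_kruskal {a : ℝ} (ha : 0 < a) : Tendsto (kruskal a) (𝓝[<] 1) atTop := by
  have hs : Tendsto (fun w : ℝ => Real.sin (Real.pi * w / 2)) (𝓝[<] 1) (𝓝 1) := by
    have : Continuous fun w : ℝ => Real.sin (Real.pi * w / 2) := by fun_prop
    simpa using (this.tendsto 1).mono_left nhdsWithin_le_nhds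
  have hc : Tendsto (fun w : ℝ => Real.cos (Real.pi * w / 2)) (𝓝[<] 1) (𝓝[>] 0) := by
    refine tendsto_nhdsWithin_iff.2 ⟨?_, ?_⟩
    · have : Continuous fun w : ℝ => Real.cos (Real.pi * w / 2) := by fun_prop
      simpa using (this.tendsto 1).mono_left nhdsWithin_le_nhds
    · filter_upwards [Ioo_mem_nhdsLT (show (-1 : ℝ) < 1 by norm_num)] with w hw
      exact cos_pos_of_abs_lt_one (abs_lt.2 hw)
  exact hs.pos_mul_atTop one_pos ((tendsto_rpow_neg_nhdsGT_zero (neg_lt_zero.2 ha)).comp hc)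

/-- Near `w = 1` the function behaves like `cos ^ (-a)`, with a cosine of at most `π/2 * (1 - w)`,
so its logarithmic derivative has a pole at `1`. This pole makes the volume near null infinity
diverge. -/
theorem mul_kruskal_le_deriv {a : ℝ} (ha : 0 < a) {w : ℝ} (h0 : 0 < w) (h1 : w < 1) :
    min 1 a / (1 - w) * kruskal a w ≤ deriv (kruskal a) w := by
  have hw : |w| < 1 := abs_lt.2 ⟨by linarith, h1⟩
  have hc := cos_pos_of_abs_lt_one hw
  have hs := sin_pos_of_pos_of_lt_one h0 h1
  have hpi := Real.pi_pos
  have h3 : 0 < min 1 a := lt_min one_pos ha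
  have hw1 : 0 < 1 - w := by linarith
  have e1 : Real.cos (Real.pi * w / 2) ^ (-a) =
      Real.cos (Real.pi * w / 2) ^ (-a - 1) * Real.cos (Real.pi * w / 2) := by
    rw [← Real.rpow_add_one hc.ne']; ring_nf
  have hcle : Real.cos (Real.pi * w / 2) ≤ Real.pi / 2 * (1 - w) := by
    have : Real.cos (Real.pi * w / 2) = Real.sin (Real.pi / 2 * (1 - w)) := by
      rw [← Real.cos_pi_div_two_sub]; ring_nf
    rw [this]
    exact Real.sin_le (by positivity)
  rw [deriv_kruskal a hw, kruskal, e1]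
  have hp : 0 < Real.cos (Real.pi * w / 2) ^ (-a - 1) := Real.rpow_pos_of_pos hc _
  calc _ ≤ min 1 a / (1 - w) * (1 * (Real.cos (Real.pi * w / 2) ^ (-a - 1) *
        (Real.pi / 2 * (1 - w)))) := by
        gcongr
        exact Real.sin_le_one _
    _ = Real.pi / 2 * min 1 a * Real.cos (Real.pi * w / 2) ^ (-a - 1) := by field_simp
    _ ≤ _ := by gcongr; exact min_le_cos_sq_add _

/-- The derivative is of order `cos ^ (-a - 1)`, the `1 + 1/a` power of `cos ^ (-a)`. The sine
factor of `kruskal` vanishes at `0`, which is why `w` has to stay above `w₀` and the constant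
depends on it. -/
theorem deriv_kruskal_le {a : ℝ} (ha : 0 < a) {w₀ w : ℝ} (h0 : 0 < w₀) (h : w₀ ≤ w) (h1 : w < 1) :
    deriv (kruskal a) w ≤
      Real.pi / 2 * (1 + a) * Real.sin (Real.pi * w₀ / 2) ^ (-(1 + 1 / a)) *
        kruskal a w ^ (1 + 1 / a) := by
  have hw : |w| < 1 := abs_lt.2 ⟨by linarith, h1⟩
  have hc := cos_pos_of_abs_lt_one hw
  have hs := sin_pos_of_pos_of_lt_one (h0.trans_le h) h1
  have hs0 := sin_pos_of_pos_of_lt_one h0 (h.trans_lt h1)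
  have hpi := Real.pi_pos
  have hss : Real.sin (Real.pi * w₀ / 2) ≤ Real.sin (Real.pi * w / 2) :=
    Real.sin_le_sin_of_le_of_le_pi_div_two (by nlinarith) (by nlinarith) (by gcongr)
  have hpow : 0 < 1 + 1 / a := by positivity
  rw [deriv_kruskal a hw, kruskal, Real.mul_rpow hs.le (by positivity), ← Real.rpow_mul hc.le,
    show -a * (1 + 1 / a) = -a - 1 by field_simp; ring]
  have hp : 0 < Real.cos (Real.pi * w / 2) ^ (-a - 1) := Real.rpow_pos_of_pos hc _
  have h4 : 1 ≤ Real.sin (Real.pi * w₀ / 2) ^ (-(1 + 1 / a)) *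
      Real.sin (Real.pi * w / 2) ^ (1 + 1 / a) := by
    rw [Real.rpow_neg hs0.le, inv_mul_eq_div, one_le_div (by positivity)]
    gcongr
  calc _ ≤ Real.pi / 2 * (1 + a) * Real.cos (Real.pi * w / 2) ^ (-a - 1) * 1 := by
        rw [mul_one]
        gcongr Real.pi / 2 * ?_ * _
        exact cos_sq_add_le ha _
    _ ≤ Real.pi / 2 * (1 + a) * Real.cos (Real.pi * w / 2) ^ (-a - 1) *
        (Real.sin (Real.pi * w₀ / 2) ^ (-(1 + 1 / a)) *
          Real.sin (Real.pi * w / 2) ^ (1 + 1 / a)) := by gcongr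
    _ = _ := by ring

theorem measurable_kruskal (a : ℝ) : Measurable (kruskal a) := by
  unfold kruskal
  fun_prop

/-! ### The area radius in the two kinds of charts -/

section
variable {m e : ℝ}

theorem kPlus_pos (he : 0 < |e|) (hem : |e| < m) : 0 < kPlus m e := by
  have hm := rMinus_pos he hem
  have hlt := rMinus_lt_rPlus hem
  have : 0 < rPlus m e := hm.trans hlt
  have : 0 < rPlus m e - rMinus m e := by linarith
  unfold kPlus
  positivity

theorem kMinus_pos (he : 0 < |e|) (hem : |e| < m) : 0 < kMinus m e := by
  have hm := rMinus_pos he hem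
  have hlt := rMinus_lt_rPlus hem
  have : 0 < rPlus m e - rMinus m e := by linarith
  unfold kMinus
  positivity

/-! ### The chart at `r₊`. -/

theorem continuousOn_outerUV : ContinuousOn (outerUV m e) (Ioi (rMinus m e)) := by
  unfold outerUV
  refine ContinuousOn.mul (ContinuousOn.mul (by fun_prop) ?_) (by fun_prop)
  exact ContinuousOn.rpow_const (by fun_prop) fun r hr => Or.inl (sub_pos.2 hr).ne'

theorem tendsto_sub_nhdsGT (c : ℝ) : Tendsto (fun r => r - c) (𝓝[>] c) (𝓝[>] 0) := by
  refine tendsto_nhdsWithin_iff.2 ⟨?_, ?_⟩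
  · have : Continuous fun r : ℝ => r - c := by fun_prop
    simpa using (this.tendsto c).mono_left nhdsWithin_le_nhds
  · filter_upwards [self_mem_nhdsWithin] with r hr
    exact sub_pos.2 (mem_Ioi.1 hr)

theorem tendsto_sub_nhdsLT (c : ℝ) : Tendsto (fun r => c - r) (𝓝[<] c) (𝓝[>] 0) := by
  refine tendsto_nhdsWithin_iff.2 ⟨?_, ?_⟩
  · have : Continuous fun r : ℝ => c - r := by fun_prop
    simpa using (this.tendsto c).mono_left nhdsWithin_le_nhds
  · filter_upwards [self_mem_nhdsWithin] with r hr
    exact sub_pos.2 (mem_Iio.1 hr)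

theorem tendsto_outerUV_nhdsGT (he : 0 < |e|) (hem : |e| < m) :
    Tendsto (outerUV m e) (𝓝[>] (rMinus m e)) atTop := by
  have ha : 0 < kPlus m e / kMinus m e := div_pos (kPlus_pos he hem) (kMinus_pos he hem)
  have h1 := (tendsto_rpow_neg_nhdsGT_zero (neg_lt_zero.2 ha)).comp
    (tendsto_sub_nhdsGT (rMinus m e))
  have hc : Continuous fun r => (rPlus m e - r) * Real.exp (2 * kPlus m e * r) := by fun_prop
  have h2 := (hc.tendsto (rMinus m e)).mono_left
    (nhdsWithin_le_nhds (s := Ioi (rMinus m e)))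
  have h3 : 0 < (rPlus m e - rMinus m e) * Real.exp (2 * kPlus m e * rMinus m e) :=
    mul_pos (sub_pos.2 (rMinus_lt_rPlus hem)) (Real.exp_pos _)
  refine (h2.pos_mul_atTop h3 h1).congr fun r => ?_
  simp only [outerUV, Function.comp]
  ring

/-- The exponential beats the negative power of `r - r₋`, and the factor `r₊ - r` supplies the sign.
-/
theorem tendsto_outerUV_atTop (he : 0 < |e|) (hem : |e| < m) :
    Tendsto (outerUV m e) atTop atBot := by
  have hk := kPlus_pos he hem
  have h1 := (tendsto_exp_mul_div_rpow_atTop (kPlus m e / kMinus m e) (2 * kPlus m e)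
    (by positivity)).comp (tendsto_atTop_add_const_right atTop (-rMinus m e) tendsto_id)
  have h2 : Tendsto (fun r => rPlus m e - r) atTop atBot :=
    tendsto_atBot_add_const_left _ _ tendsto_neg_atTop_atBot
  have h3 := (h2.atBot_mul_atTop₀ h1).atBot_mul_const
    (Real.exp_pos (2 * kPlus m e * rMinus m e))
  refine h3.congr' ?_
  filter_upwards [eventually_gt_atTop (rMinus m e)] with r hr
  have hp : 0 < r + -rMinus m e := by linarith
  have e1 : Real.exp (2 * kPlus m e * r) = Real.exp (2 * kPlus m e * (r + -rMinus m e)) *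
      Real.exp (2 * kPlus m e * rMinus m e) := by rw [← Real.exp_add]; ring_nf
  simp only [outerUV, Function.comp, id, Real.rpow_neg (sub_pos.2 hr).le]
  rw [e1, ← sub_eq_add_neg]
  ring

/-- By the intermediate value theorem `outerUV` is onto. Injectivity is never needed: all later
estimates hold for any preimage in `(r₋, ∞)`. -/
theorem outerR_spec (he : 0 < |e|) (hem : |e| < m) (x : ℝ) :
    rMinus m e < outerR m e x ∧ outerUV m e (outerR m e x) = x := by
  have h : x ∈ outerUV m e '' Ioi (rMinus m e) :=
    isPreconnected_Ioi.intermediate_value_Iii (l₁ := atTop) (l₂ := 𝓝[>] (rMinus m e))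
      (le_principal_iff.2 (Ioi_mem_atTop _)) (le_principal_iff.2 self_mem_nhdsWithin)
      continuousOn_outerUV (tendsto_outerUV_atTop he hem) (tendsto_outerUV_nhdsGT he hem)
      (mem_univ x)
  exact ⟨Function.invFunOn_mem h, Function.invFunOn_eq h⟩

theorem outerUV_pos_iff {r : ℝ} (hr : rMinus m e < r) : 0 < outerUV m e r ↔ r < rPlus m e := by
  have h : 0 < (r - rMinus m e) ^ (-(kPlus m e / kMinus m e)) :=
    Real.rpow_pos_of_pos (sub_pos.2 hr) _
  rw [outerUV, mul_pos_iff_of_pos_right (Real.exp_pos _), mul_pos_iff_of_pos_right h, sub_pos]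

theorem outerUV_neg_iff {r : ℝ} (hr : rMinus m e < r) : outerUV m e r < 0 ↔ rPlus m e < r := by
  have h : 0 < (r - rMinus m e) ^ (-(kPlus m e / kMinus m e)) :=
    Real.rpow_pos_of_pos (sub_pos.2 hr) _
  rw [outerUV, ← neg_pos, ← neg_mul, ← neg_mul, mul_pos_iff_of_pos_right (Real.exp_pos _),
    mul_pos_iff_of_pos_right h, neg_sub, sub_pos]

theorem exists_add_le_of_outerUV_le (he : 0 < |e|) (hem : |e| < m) (x : ℝ) :
    ∃ δ > 0, ∀ r, rMinus m e < r → outerUV m e r ≤ x → rMinus m e + δ ≤ r := by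
  have h := (tendsto_outerUV_nhdsGT he hem).eventually_gt_atTop x
  obtain ⟨b, hb, h⟩ := (mem_nhdsGT_iff_exists_Ioo_subset).1 h
  refine ⟨b - rMinus m e, sub_pos.2 hb, fun r hr hx => ?_⟩
  by_contra! hlt
  exact absurd (h ⟨hr, by linarith⟩) (not_lt.2 hx)

theorem exists_lt_of_outerUV_lt (hem : |e| < m) (R : ℝ) :
    ∃ x, ∀ r, rMinus m e < r → outerUV m e r < x → R < r := by
  have hlt := rMinus_lt_rPlus hem
  obtain ⟨b, hb⟩ := (isCompact_Icc (a := rPlus m e) (b := R)).bddBelow_image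
    (continuousOn_outerUV.mono fun r hr => hlt.trans_le hr.1)
  -- The `0` forces `r > r₊`; the bound `b` on the compact interval `[r₊, R]` then excludes `r ≤ R`.
  refine ⟨min b 0, fun r hr hx => ?_⟩
  by_contra! hle
  have h1 := (outerUV_neg_iff hr).1 (hx.trans_le (min_le_right _ _))
  exact absurd (hb (mem_image_of_mem _ ⟨h1.le, hle⟩)) (not_le.2 (hx.trans_le (min_le_left _ _)))

theorem outerF_pos (he : 0 < |e|) (hem : |e| < m) {r : ℝ} (hr : rMinus m e < r) :
    0 < outerF m e r := by
  have := kPlus_pos he hem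
  have : 0 < r := (rMinus_pos he hem).trans hr
  have : 0 < r - rMinus m e := sub_pos.2 hr
  unfold outerF
  positivity

theorem le_outerF (he : 0 < |e|) (hem : |e| < m) {δ r : ℝ} (hδ : 0 < δ)
    (h1 : rMinus m e + δ ≤ r) (h2 : r ≤ rPlus m e) :
    δ ^ (1 + kPlus m e / kMinus m e) * Real.exp (-(2 * kPlus m e * rPlus m e)) /
      (kPlus m e ^ 2 * rPlus m e ^ 2) ≤ outerF m e r := by
  have hk := kPlus_pos he hem
  have hk' := kMinus_pos he hem
  have : 0 < r := by linarith [rMinus_pos he hem]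
  have : 0 < r - rMinus m e := by linarith
  unfold outerF
  gcongr
  linarith

theorem outerF_mul_sq (he : 0 < |e|) (hem : |e| < m) {r : ℝ} (hr : rMinus m e < r) :
    outerF m e r * r ^ 2 * outerUV m e r =
      (rPlus m e - r) * (r - rMinus m e) / kPlus m e ^ 2 := by
  have h0 : r ≠ 0 := ((rMinus_pos he hem).trans hr).ne'
  have hk := (kPlus_pos he hem).ne'
  rw [mul_right_comm, outerF_mul_outerUV he hem hr, f_eq hem h0]
  field_simp
  ring

/-- Both sides are compared with powers of `r - r₋`: `outerUV ≤ c (r - r₋)^(-a)`, and `outerF r²` is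
`(r - r₋)^(1 + a)` up to bounded factors. The exponent is exactly what `deriv_kruskal_le` costs in
each null direction. -/
theorem exists_outerF_mul_sq_le (he : 0 < |e|) (hem : |e| < m) :
    ∃ C > 0, ∀ r, rMinus m e < r → r < rPlus m e → outerF m e r * r ^ 2 ≤
      C * outerUV m e r ^ (-(1 + 1 / (kPlus m e / kMinus m e))) := by
  have hk := kPlus_pos he hem
  have hk' := kMinus_pos he hem
  have hlt := rMinus_lt_rPlus hem
  set a := kPlus m e / kMinus m e with ha_def
  have ha : 0 < a := div_pos hk hk'
  have hd : 0 < rPlus m e - rMinus m e := sub_pos.2 hlt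
  set c := (rPlus m e - rMinus m e) * Real.exp (2 * kPlus m e * rPlus m e) with hc_def
  have hc : 0 < c := by positivity
  refine ⟨c ^ (1 + 1 / a) / kPlus m e ^ 2, by positivity, fun r h1 h2 => ?_⟩
  have hr : 0 < r - rMinus m e := sub_pos.2 h1
  have hx := (outerUV_pos_iff h1).2 h2
  have hr0 : 0 < r := (rMinus_pos he hem).trans h1
  have hxle : outerUV m e r ≤ c * (r - rMinus m e) ^ (-a) := by
    rw [outerUV, ← ha_def, hc_def, mul_right_comm]
    gcongr
  have hle : (r - rMinus m e) ^ (1 + a) ≤ c ^ (1 + 1 / a) *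
      outerUV m e r ^ (-(1 + 1 / a)) := by
    have h3 : outerUV m e r ^ (1 + 1 / a) ≤ c ^ (1 + 1 / a) * (r - rMinus m e) ^ (-(1 + a)) := by
      calc _ ≤ (c * (r - rMinus m e) ^ (-a)) ^ (1 + 1 / a) := by gcongr
        _ = _ := by
          rw [Real.mul_rpow hc.le (by positivity), ← Real.rpow_mul hr.le]
          congr 2
          field_simp
          ring
    rw [Real.rpow_neg hr.le] at h3
    rw [Real.rpow_neg hx.le]
    rw [← div_eq_mul_inv] at h3 ⊢
    rw [le_div_iff₀ (by positivity)] at h3 ⊢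
    linarith
  have hF : outerF m e r * r ^ 2 = (r - rMinus m e) ^ (1 + a) *
      Real.exp (-(2 * kPlus m e * r)) / kPlus m e ^ 2 := by
    rw [outerF, ← ha_def]
    field_simp
  rw [hF]
  have hexp : Real.exp (-(2 * kPlus m e * r)) ≤ 1 := Real.exp_le_one_iff.2 (by
    have : 0 < 2 * kPlus m e * r := by positivity
    linarith)
  calc _ ≤ (r - rMinus m e) ^ (1 + a) * 1 / kPlus m e ^ 2 := by gcongr
    _ ≤ c ^ (1 + 1 / a) * outerUV m e r ^ (-(1 + 1 / a)) * 1 / kPlus m e ^ 2 := by gcongr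
    _ = _ := by ring

/-! ### The chart at `r₋`. -/

theorem innerUV_zero_neg (he : 0 < |e|) (hem : |e| < m) : innerUV m e 0 < 0 := by
  have hm := rMinus_pos he hem
  have hp : 0 < rPlus m e := hm.trans (rMinus_lt_rPlus hem)
  have h : 0 < rMinus m e * rPlus m e ^ (-(kMinus m e / kPlus m e)) := by positivity
  simp only [innerUV, zero_sub, sub_zero, mul_zero, neg_zero, Real.exp_zero, mul_one]
  linarith

theorem innerR_spec (he : 0 < |e|) (hem : |e| < m) {x : ℝ} (hx : innerUV m e 0 < x) :
    innerR m e x ∈ Ioo 0 (rPlus m e) := by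
  have hm := rMinus_pos he hem
  have hp : 0 < rPlus m e := hm.trans (rMinus_lt_rPlus hem)
  have hb : 0 < kMinus m e / kPlus m e := div_pos (kMinus_pos he hem) (kPlus_pos he hem)
  have hcont : ContinuousOn (innerUV m e) (Iio (rPlus m e)) := by
    unfold innerUV
    refine ContinuousOn.mul (ContinuousOn.mul (by fun_prop) ?_) (by fun_prop)
    exact ContinuousOn.rpow_const (by fun_prop) fun r hr => Or.inl (sub_pos.2 hr).ne'
  have h1 : Tendsto (innerUV m e) (𝓝[>] 0) (𝓝 (innerUV m e 0)) :=
    (hcont.continuousAt (Iio_mem_nhds hp)).tendsto.mono_left nhdsWithin_le_nhds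
  have h2 : Tendsto (innerUV m e) (𝓝[<] (rPlus m e)) atTop := by
    have h1 := (tendsto_rpow_neg_nhdsGT_zero (neg_lt_zero.2 hb)).comp
      (tendsto_sub_nhdsLT (rPlus m e))
    have hc : Continuous fun r => (r - rMinus m e) * Real.exp (-(2 * kMinus m e * r)) := by
      fun_prop
    have h2 := (hc.tendsto (rPlus m e)).mono_left
      (nhdsWithin_le_nhds (s := Iio (rPlus m e)))
    have h3 : 0 < (rPlus m e - rMinus m e) * Real.exp (-(2 * kMinus m e * rPlus m e)) :=
      mul_pos (sub_pos.2 (rMinus_lt_rPlus hem)) (Real.exp_pos _)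
    refine (h2.pos_mul_atTop h3 h1).congr fun r => ?_
    simp only [innerUV, Function.comp]
    ring
  have h : x ∈ innerUV m e '' Ioo 0 (rPlus m e) :=
    isPreconnected_Ioo.intermediate_value_Ioi (le_principal_iff.2 (Ioo_mem_nhdsGT hp))
      (le_principal_iff.2 (Ioo_mem_nhdsLT hp)) (hcont.mono fun r hr => hr.2) h1 h2 hx
  exact Function.invFunOn_mem h

theorem innerF_pos (he : 0 < |e|) (hem : |e| < m) {r : ℝ} (hr : r ∈ Ioo 0 (rPlus m e)) :
    0 < innerF m e r := by
  have := kMinus_pos he hem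
  have : 0 < r := hr.1
  have : 0 < rPlus m e - r := sub_pos.2 hr.2
  unfold innerF
  positivity

end

end RN

namespace DoubleNull

variable {S : DoubleNull}

/-! ### Timelike curves and volumes in double null coordinates -/

theorem TimelikeCurve.lt {p q : S.Event} (h : S.TimelikeCurve p q) :
    (p.1 : ℝ × ℝ).1 < (q.1 : ℝ × ℝ).1 ∧ (p.1 : ℝ × ℝ).2 < (q.1 : ℝ × ℝ).2 := by
  obtain ⟨c, y, hc, -, h0, -, h1, -, h⟩ := h
  have hd : ∀ s ∈ Icc (0 : ℝ) 1, HasDerivWithinAt c (derivWithin c (Icc 0 1) s) (Icc 0 1) s :=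
    fun s hs => (hc.differentiableOn (by simp) s hs).hasDerivWithinAt
  have hI : interior (Icc (0 : ℝ) 1) ⊆ Icc 0 1 := interior_subset
  rw [← h0, ← h1]
  constructor
  · have := strictMonoOn_of_hasDerivWithinAt_pos (convex_Icc (0 : ℝ) 1)
      (f := fun s => (c s).1) (f' := fun s => (derivWithin c (Icc 0 1) s).1)
      (continuous_fst.comp_continuousOn hc.continuousOn)
      (fun s hs => ((ContinuousLinearMap.fst ℝ ℝ ℝ).hasFDerivAt.comp_hasDerivWithinAt s
        (hd s (hI hs))).mono hI)
      (fun s hs => (h s (hI hs)).2.2.2.1)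
    exact this (by simp) (by simp) one_pos
  · have := strictMonoOn_of_hasDerivWithinAt_pos (convex_Icc (0 : ℝ) 1)
      (f := fun s => (c s).2) (f' := fun s => (derivWithin c (Icc 0 1) s).2)
      (continuous_snd.comp_continuousOn hc.continuousOn)
      (fun s hs => ((ContinuousLinearMap.snd ℝ ℝ ℝ).hasFDerivAt.comp_hasDerivWithinAt s
        (hd s (hI hs))).mono hI)
      (fun s hs => (h s (hI hs)).2.2.2.2)
    exact this (by simp) (by simp) one_pos

theorem lt_of_mem_chronFuture {p q : S.Event} (h : q ∈ S.chronFuture p) :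
    (p.1 : ℝ × ℝ).1 < (q.1 : ℝ × ℝ).1 ∧ (p.1 : ℝ × ℝ).2 < (q.1 : ℝ × ℝ).2 := by
  induction h with
  | single h => exact h.lt
  | tail _ h ih => exact ⟨ih.1.trans h.lt.1, ih.2.trans h.lt.2⟩

/-- A straight segment in the `(u,v)`-plane is combined with a path `y` on the sphere; it is
timelike if the angular speed is small against the constant `du dv`. -/
theorem timelikeCurve_of_segment {p q : S.Event} (hu : (p.1 : ℝ × ℝ).1 < (q.1 : ℝ × ℝ).1)
    (hv : (p.1 : ℝ × ℝ).2 < (q.1 : ℝ × ℝ).2) {y : ℝ → E3} (hy : ContDiffOn ℝ ∞ y (Icc 0 1))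
    (hy0 : y 0 = p.2) (hy1 : y 1 = q.2)
    (h : ∀ s ∈ Icc (0 : ℝ) 1, (p.1 + s • (q.1 - p.1 : ℝ × ℝ) : ℝ × ℝ) ∈ S.Q ∧
      y s ∈ sphere (0 : E3) 1 ∧
      S.r (p.1 + s • (q.1 - p.1 : ℝ × ℝ)) ^ 2 * ‖derivWithin y (Icc 0 1) s‖ ^ 2 <
        S.F (p.1 + s • (q.1 - p.1 : ℝ × ℝ)) *
          (((q.1 : ℝ × ℝ).1 - (p.1 : ℝ × ℝ).1) * ((q.1 : ℝ × ℝ).2 - (p.1 : ℝ × ℝ).2))) :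
    S.TimelikeCurve p q := by
  refine ⟨fun s => p.1 + s • (q.1 - p.1 : ℝ × ℝ), y, by fun_prop, hy, by simp, hy0, by simp, hy1,
    fun s hs => ?_⟩
  have hd : derivWithin (fun s : ℝ => (p.1 + s • (q.1 - p.1 : ℝ × ℝ) : ℝ × ℝ)) (Icc 0 1) s =
      q.1 - p.1 := by
    have : HasDerivAt (fun s : ℝ => (p.1 + s • (q.1 - p.1 : ℝ × ℝ) : ℝ × ℝ))
        ((1 : ℝ) • (q.1 - p.1 : ℝ × ℝ)) s :=
      ((hasDerivAt_id s).smul_const _).const_add _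
    rw [one_smul] at this
    exact this.hasDerivWithinAt.derivWithin (uniqueDiffOn_Icc one_pos s hs)
  obtain ⟨h1, h2, h3⟩ := h s hs
  rw [hd]
  refine ⟨h1, h2, ?_, sub_pos.2 hu, sub_pos.2 hv⟩
  simp only [normSq, Prod.fst_sub, Prod.snd_sub]
  linarith

theorem vol_le {T : Set S.Event} {A : Set (ℝ × ℝ)} (hA : MeasurableSet A) {K : ℝ}
    (hT : ∀ x ∈ T, (x.1 : ℝ × ℝ) ∈ A) (hK : ∀ x ∈ S.Q ∩ A, S.F x / 2 * S.r x ^ 2 ≤ K) :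
    S.vol T ≤ ENNReal.ofReal K * (volume A * (volume : Measure E3).toSphere univ) := by
  have hm : MeasurableSet (((Subtype.val : S.Q → ℝ × ℝ) ⁻¹' A) ×ˢ (univ : Set S2)) :=
    (measurable_subtype_coe hA).prod MeasurableSet.univ
  calc S.vol T ≤ S.vol (((Subtype.val : S.Q → ℝ × ℝ) ⁻¹' A) ×ˢ (univ : Set S2)) :=
        measure_mono fun x hx => ⟨hT x hx, mem_univ _⟩
    _ ≤ ∫⁻ _ in (((Subtype.val : S.Q → ℝ × ℝ) ⁻¹' A) ×ˢ (univ : Set S2)), ENNReal.ofReal K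
        ∂(((volume : Measure (ℝ × ℝ)).comap (Subtype.val : S.Q → ℝ × ℝ)).prod
          (volume : Measure E3).toSphere) := by
        rw [vol, withDensity_apply _ hm]
        exact setLIntegral_mono' hm fun x hx =>
          ENNReal.ofReal_le_ofReal (hK _ ⟨x.1.2, hx.1⟩)
    _ ≤ _ := by
        rw [setLIntegral_const, Measure.prod_prod]
        gcongr
        -- Only an inequality for `comap` is needed, so `S.Q` need not be measurable here, in
        -- contrast to `le_vol`.
        refine (Measure.comap_apply_le _ _ (measurable_subtype_coe hA).nullMeasurableSet).trans
          (measure_mono ?_)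
        exact image_preimage_subset _ _

theorem le_vol (hQ : MeasurableSet S.Q) {T : Set S.Event} {A : Set (ℝ × ℝ)}
    (hA : MeasurableSet A) (hAQ : A ⊆ S.Q) {B : Set S2} (hB : MeasurableSet B) {K : ℝ}
    (hT : ∀ x : S.Event, (x.1 : ℝ × ℝ) ∈ A → x.2 ∈ B → x ∈ T)
    (hK : ∀ x ∈ A, K ≤ S.F x / 2 * S.r x ^ 2) :
    ENNReal.ofReal K * (volume A * (volume : Measure E3).toSphere B) ≤ S.vol T := by
  have hm : MeasurableSet (((Subtype.val : S.Q → ℝ × ℝ) ⁻¹' A) ×ˢ B) :=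
    (measurable_subtype_coe hA).prod hB
  calc _ = ∫⁻ _ in (((Subtype.val : S.Q → ℝ × ℝ) ⁻¹' A) ×ˢ B), ENNReal.ofReal K
        ∂(((volume : Measure (ℝ × ℝ)).comap (Subtype.val : S.Q → ℝ × ℝ)).prod
          (volume : Measure E3).toSphere) := by
        rw [setLIntegral_const, Measure.prod_prod,
          (MeasurableEmbedding.subtype_coe hQ).comap_apply, Subtype.image_preimage_coe,
          inter_eq_right.2 hAQ]
    _ ≤ S.vol (((Subtype.val : S.Q → ℝ × ℝ) ⁻¹' A) ×ˢ B) := by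
        rw [vol, withDensity_apply _ hm]
        exact setLIntegral_mono' hm fun x hx => ENNReal.ofReal_le_ofReal (hK _ hx.1)
    _ ≤ S.vol T := measure_mono fun x hx => hT x hx.1 hx.2

end DoubleNull

/-- Straight paths in the ambient space project to short paths on the sphere. -/
theorem exists_sphere_path (y₀ : S2) {ε : ℝ} (hε : 0 < ε) :
    ∃ η > 0, ∀ z : S2, dist z y₀ < η → ∃ y : ℝ → E3, ContDiffOn ℝ ∞ y (Icc 0 1) ∧
      y 0 = y₀ ∧ y 1 = z ∧ ∀ s ∈ Icc (0 : ℝ) 1, y s ∈ sphere (0 : E3) 1 ∧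
        ‖derivWithin y (Icc 0 1) s‖ < ε := by
  set N : E3 → E3 := fun x => ‖x‖⁻¹ • x with hN
  have hNs : ∀ x ≠ 0, ContDiffAt ℝ ∞ N x := fun x hx =>
    ((contDiffAt_norm ℝ hx).inv (norm_ne_zero_iff.2 hx)).smul contDiffAt_id
  have hn : ∀ z : S2, ‖(z : E3)‖ = 1 := fun z => by simp
  have hy0 : (y₀ : E3) ≠ 0 := norm_ne_zero_iff.1 (by simp)
  have hcont : ContinuousAt (fun x => ‖fderiv ℝ N x‖) (y₀ : E3) :=
    ((hNs _ hy0).continuousAt_fderiv (by simp)).norm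
  -- A bound for the derivative of the radial projection near `y₀`; the projected path has speed at
  -- most `K` times the length of the chord.
  set K : ℝ := ‖fderiv ℝ N y₀‖ + 1 with hK
  have hKpos : 0 < K := by positivity
  have hev : ∀ᶠ x in 𝓝 (y₀ : E3), ‖fderiv ℝ N x‖ < K ∧ x ≠ 0 :=
    (hcont.eventually_lt_const (by rw [hK]; linarith)).and (eventually_ne_nhds hy0)
  obtain ⟨ρ, hρ, hball⟩ := Metric.eventually_nhds_iff_ball.1 hev
  refine ⟨min ρ (ε / K), by positivity, fun z hz => ?_⟩
  have hz1 : (z : E3) ∈ ball (y₀ : E3) ρ := hz.trans_le (min_le_left _ _)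
  have hz2 : ‖(z : E3) - y₀‖ < ε / K := by
    rw [← dist_eq_norm]; exact hz.trans_le (min_le_right _ _)
  have hg : ∀ s ∈ Icc (0 : ℝ) 1, (y₀ + s • (z - y₀ : E3) : E3) ∈ ball (y₀ : E3) ρ := fun s hs =>
    (convex_ball _ _).add_smul_sub_mem (mem_ball_self hρ) hz1 hs
  refine ⟨fun s => N (y₀ + s • (z - y₀ : E3)), fun s hs => ?_, by simp [hN], by simp [hN],
    fun s hs => ⟨?_, ?_⟩⟩
  · have h1 : ContDiffAt ℝ ∞ (fun s : ℝ => (y₀ + s • (z - y₀ : E3) : E3)) s := by fun_prop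
    exact ((hNs _ (hball _ (hg s hs)).2).comp s h1).contDiffWithinAt
  · have := norm_ne_zero_iff.2 (hball _ (hg s hs)).2
    rw [mem_sphere_zero_iff_norm, hN]
    simp only [norm_smul, norm_inv, norm_norm]
    exact inv_mul_cancel₀ this
  · have h1 : HasDerivAt (fun s : ℝ => (y₀ + s • (z - y₀ : E3) : E3))
        ((1 : ℝ) • (z - y₀ : E3)) s := ((hasDerivAt_id s).smul_const _).const_add _
    rw [one_smul] at h1
    have h2 := ((hNs _ (hball _ (hg s hs)).2).differentiableAt (by simp)).hasFDerivAt.comp_hasDerivAt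
      s h1
    have h3 : derivWithin (fun s => N (y₀ + s • (z - y₀ : E3))) (Icc 0 1) s =
        fderiv ℝ N (y₀ + s • (z - y₀ : E3)) (z - y₀) :=
      h2.hasDerivWithinAt.derivWithin (uniqueDiffOn_Icc one_pos s hs)
    rw [h3]
    calc _ ≤ ‖fderiv ℝ N (y₀ + s • (z - y₀ : E3))‖ * ‖(z - y₀ : E3)‖ :=
          ContinuousLinearMap.le_opNorm _ _
      _ ≤ K * ‖(z - y₀ : E3)‖ := by gcongr; exact (hball _ (hg s hs)).1.le
      _ < K * (ε / K) := by gcongr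
      _ = ε := by field_simp

namespace RN

/-! ### The metric coefficients on the stack -/

variable {m e : ℝ}

theorem evenIndex_eq {u : ℝ} {n : ℤ} (h : |u - (2 * n : ℤ)| < 1) : evenIndex u = 2 * n := by
  push_cast at h
  obtain ⟨h1, h2⟩ := abs_lt.1 h
  have : round (u / 2) = n := by
    rw [round_eq, Int.floor_eq_iff]
    constructor <;> linarith
  rw [evenIndex, this]

theorem oddIndex_eq {u : ℝ} {n : ℤ} (h : |u - (2 * n + 1 : ℤ)| < 1) :
    oddIndex u = 2 * n + 1 := by
  push_cast at h
  obtain ⟨h1, h2⟩ := abs_lt.1 h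
  have : ⌊u / 2⌋ = n := by
    rw [Int.floor_eq_iff]
    constructor <;> linarith
  rw [oddIndex, this]

theorem radius_of_mem_square {n : ℤ} {x : ℝ × ℝ} (hx : x ∈ square (2 * n)) :
    radius m e x = outerR m e (outerProd m e (2 * n) x) := by
  rw [radius, evenIndex_eq hx.1, if_pos hx]

theorem coeff_of_mem_square {n : ℤ} {x : ℝ × ℝ} (hx : x ∈ square (2 * n)) :
    coeff m e x = outerF m e (outerR m e (outerProd m e (2 * n) x)) *
      deriv (kruskal (kPlus m e / kMinus m e)) (x.1 - (2 * n : ℤ)) *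
      deriv (kruskal (kPlus m e / kMinus m e)) (x.2 - (2 * n : ℤ)) := by
  rw [coeff, evenIndex_eq hx.1, if_pos hx]

/-- Positivity makes every segment in `Q` with increasing `u` and `v` and constant angle timelike.
-/
theorem coeff_pos (he : 0 < |e|) (hem : |e| < m) {x : ℝ × ℝ} (hx : x ∈ (maximalExtension m e).Q) :
    0 < coeff m e x := by
  have hk := kPlus_pos he hem
  have hk' := kMinus_pos he hem
  by_cases h : x ∈ square (evenIndex x.1)
  · rw [coeff, if_pos h]
    exact mul_pos (mul_pos (outerF_pos he hem (outerR_spec he hem _).1)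
      (deriv_kruskal_pos (div_pos hk hk') h.1)) (deriv_kruskal_pos (div_pos hk hk') h.2)
  · obtain ⟨n, hn | hn⟩ := hx
    · exact absurd (by rwa [evenIndex_eq hn.1]) h
    · rw [coeff, if_neg h, oddIndex_eq hn.1.1]
      exact mul_pos (mul_pos (innerF_pos he hem (innerR_spec he hem hn.2))
        (deriv_kruskal_pos (div_pos hk' hk) hn.1.1)) (deriv_kruskal_pos (div_pos hk' hk) hn.1.2)

theorem square_eq (k : ℤ) : square k = Ioo (k - 1 : ℝ) (k + 1) ×ˢ Ioo (k - 1 : ℝ) (k + 1) := by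
  ext x
  simp only [square, mem_ofPred_eq, abs_lt, mem_prod, mem_Ioo]
  constructor <;> rintro ⟨⟨h1, h2⟩, h3, h4⟩ <;> refine ⟨⟨?_, ?_⟩, ?_, ?_⟩ <;> linarith

theorem measurableSet_maximalExtension : MeasurableSet (maximalExtension m e).Q := by
  have hsq : ∀ k, MeasurableSet (square k) := fun k => by
    rw [square_eq]
    exact measurableSet_Ioo.prod measurableSet_Ioo
  have hin : ∀ k, MeasurableSet (innerChart m e k) := fun k => by
    have hk := measurable_kruskal (kMinus m e / kPlus m e)
    have hprod : Measurable (innerProd m e k) :=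
      (hk.comp (measurable_fst.sub_const _)).mul (hk.comp (measurable_snd.sub_const _))
    have hlt : MeasurableSet {x | innerUV m e 0 < innerProd m e k x} :=
      measurableSet_lt measurable_const hprod
    exact (hsq k).inter hlt
  have : (maximalExtension m e).Q =
      ⋃ n : ℤ, (square (2 * n) ∪ innerChart m e (2 * n + 1)) := by
    ext x
    simp [maximalExtension]
  rw [this]
  exact MeasurableSet.iUnion fun n => (hsq _).union (hin _)

/-! ### The region `r > r₋` -/

theorem exists_density_le (he : 0 < |e|) (hem : |e| < m) {w₀ : ℝ} (h0 : 0 < w₀) :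
    ∃ K, ∀ x ∈ square 0, w₀ ≤ x.1 → w₀ ≤ x.2 → coeff m e x / 2 * radius m e x ^ 2 ≤ K := by
  have ha : 0 < kPlus m e / kMinus m e := div_pos (kPlus_pos he hem) (kMinus_pos he hem)
  obtain ⟨C, hC, hCle⟩ := exists_outerF_mul_sq_le he hem
  set a := kPlus m e / kMinus m e with ha_def
  set M := Real.pi / 2 * (1 + a) * Real.sin (Real.pi * w₀ / 2) ^ (-(1 + 1 / a)) with hM
  refine ⟨C * M ^ 2 / 2, fun x hx h1 h2 => ?_⟩
  have hx' : x ∈ square (2 * 0) := hx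
  rw [coeff_of_mem_square hx', radius_of_mem_square hx', ← ha_def]
  have hx1 : |x.1| < 1 := by simpa using hx.1
  have hx2 : |x.2| < 1 := by simpa using hx.2
  have hU := (kruskal_pos_iff ha hx1).2 (h0.trans_le h1)
  have hV := (kruskal_pos_iff ha hx2).2 (h0.trans_le h2)
  have hprod : outerProd m e (2 * 0) x = kruskal a x.1 * kruskal a x.2 := by
    simp [outerProd, ← ha_def]
  rw [hprod]
  obtain ⟨hr1, hr2⟩ := outerR_spec he hem (kruskal a x.1 * kruskal a x.2)
  set r := outerR m e (kruskal a x.1 * kruskal a x.2)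
  have hr3 : r < rPlus m e := (outerUV_pos_iff hr1).1 (by rw [hr2]; positivity)
  have hF := hCle r hr1 hr3
  rw [hr2, Real.mul_rpow hU.le hV.le, Real.rpow_neg hU.le, Real.rpow_neg hV.le] at hF
  have hd1 := deriv_kruskal_le ha h0 h1 (abs_lt.1 hx1).2
  have hd2 := deriv_kruskal_le ha h0 h2 (abs_lt.1 hx2).2
  rw [← hM] at hd1 hd2
  have hd1p := deriv_kruskal_pos ha hx1
  have hd2p := deriv_kruskal_pos ha hx2
  have hMp : 0 ≤ M := by
    have : 0 < kruskal a x.1 ^ (1 + 1 / a) := by positivity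
    by_contra! hneg
    have := mul_neg_of_neg_of_pos hneg this
    linarith
  simp only [mul_zero, Int.cast_zero, sub_zero]
  calc _ = (outerF m e r * r ^ 2) * (deriv (kruskal a) x.1 * deriv (kruskal a) x.2) / 2 := by ring
    -- The decay of `outerF r²` cancels the growth of the two derivatives exactly.
    _ ≤ (C * ((kruskal a x.1 ^ (1 + 1 / a))⁻¹ * (kruskal a x.2 ^ (1 + 1 / a))⁻¹)) *
        ((M * kruskal a x.1 ^ (1 + 1 / a)) * (M * kruskal a x.2 ^ (1 + 1 / a))) / 2 := by
        gcongr
    _ = _ := by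
        have := (Real.rpow_pos_of_pos hU (1 + 1 / a)).ne'
        have := (Real.rpow_pos_of_pos hV (1 + 1 / a)).ne'
        field_simp

theorem exists_vol_chronFuture_le (he : 0 < |e|) (hem : |e| < m) {D : Set (ℝ × ℝ)}
    (hD : D ⊆ square 0) {w₀ : ℝ} (h0 : 0 < w₀) :
    ∃ K, ∀ p : ((maximalExtension m e).restrict D).Event, w₀ ≤ (p.1 : ℝ × ℝ).1 →
      w₀ ≤ (p.1 : ℝ × ℝ).2 →
      ((maximalExtension m e).restrict D).vol
        (((maximalExtension m e).restrict D).chronFuture p) ≤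
      ENNReal.ofReal K * (ENNReal.ofReal ((1 - (p.1 : ℝ × ℝ).1) * (1 - (p.1 : ℝ × ℝ).2)) *
        (volume : Measure E3).toSphere univ) := by
  obtain ⟨K, hK⟩ := exists_density_le he hem h0
  refine ⟨K, fun p hp1 hp2 => ?_⟩
  have hsq : ∀ x ∈ ((maximalExtension m e).restrict D).Q, |x.1| < 1 ∧ |x.2| < 1 := fun x hx => by
    simpa [square] using hD hx.2
  have hp := hsq _ p.1.2
  refine (DoubleNull.vol_le
    (A := Ioo (p.1 : ℝ × ℝ).1 1 ×ˢ Ioo (p.1 : ℝ × ℝ).2 1) (K := K)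
    (measurableSet_Ioo.prod measurableSet_Ioo) (fun x hx => ?_) fun x hx => ?_).trans_eq ?_
  · have h1 := DoubleNull.lt_of_mem_chronFuture hx
    have h2 := hsq _ x.1.2
    exact ⟨⟨h1.1, (abs_lt.1 h2.1).2⟩, h1.2, (abs_lt.1 h2.2).2⟩
  · exact hK x (hD hx.1.2) (hp1.trans hx.2.1.1.le) (hp2.trans hx.2.2.1.le)
  · rw [Measure.volume_eq_prod, Measure.prod_prod, Real.volume_Ioo, Real.volume_Ioo,
      ENNReal.ofReal_mul (by linarith [(abs_lt.1 hp.1).2])]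

theorem vol_chronFuture_lt_top (he : 0 < |e|) (hem : |e| < m) {D : Set (ℝ × ℝ)}
    (hD : D ⊆ square 0) (p : ((maximalExtension m e).restrict D).Event)
    (hu : 0 < (p.1 : ℝ × ℝ).1) (hv : 0 < (p.1 : ℝ × ℝ).2) :
    ((maximalExtension m e).restrict D).vol
      (((maximalExtension m e).restrict D).chronFuture p) < ⊤ := by
  obtain ⟨K, hK⟩ := exists_vol_chronFuture_le he hem hD (lt_min hu hv)
  exact (hK p (min_le_left _ _) (min_le_right _ _)).trans_lt
    (ENNReal.mul_lt_top ENNReal.ofReal_lt_top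
      (ENNReal.mul_lt_top ENNReal.ofReal_lt_top (measure_lt_top _ _)))

/-- For `r < r₊` the product `U V` is positive: the two alternatives are the black-hole and the
white-hole quadrant. -/
theorem pos_or_neg_of_radius_lt (he : 0 < |e|) (hem : |e| < m) {x : ℝ × ℝ} (hx : x ∈ square 0)
    (hr : radius m e x < rPlus m e) : 0 < x.1 ∧ 0 < x.2 ∨ x.1 < 0 ∧ x.2 < 0 := by
  have ha : 0 < kPlus m e / kMinus m e := div_pos (kPlus_pos he hem) (kMinus_pos he hem)
  rw [radius_of_mem_square (n := 0) hx] at hr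
  obtain ⟨hr1, hr2⟩ := outerR_spec he hem (outerProd m e (2 * 0) x)
  have h := (outerUV_pos_iff hr1).2 hr
  have hx1 : |x.1| < 1 := by simpa using hx.1
  have hx2 : |x.2| < 1 := by simpa using hx.2
  rw [hr2] at h
  simp only [outerProd, mul_zero, Int.cast_zero, sub_zero] at h
  rwa [mul_pos_iff, kruskal_pos_iff ha hx1, kruskal_pos_iff ha hx2, kruskal_neg_iff ha hx1,
    kruskal_neg_iff ha hx2] at h

theorem rMinus_lt_radius (he : 0 < |e|) (hem : |e| < m) {x : ℝ × ℝ} (hx : x ∈ square 0) :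
    rMinus m e < radius m e x := by
  rw [radius_of_mem_square (n := 0) hx]
  exact (outerR_spec he hem _).1

theorem futureVolumeIncomplete_restrict (he : 0 < |e|) (hem : |e| < m) {D : Set (ℝ × ℝ)}
    (hD : D ⊆ square 0) (hdiag : ∀ t : ℝ, 0 < t → t < 1 → (t, t) ∈ D) :
    FutureVolumeIncomplete ((maximalExtension m e).restrict D).chronFuture
      ((maximalExtension m e).restrict D).vol := by
  intro ε hε
  obtain ⟨K, hK⟩ := exists_vol_chronFuture_le he hem hD (w₀ := 1 / 2) (by norm_num)
  set σ := ((volume : Measure E3).toSphere univ).toReal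
  -- The sign of `K` is not known, hence the maximum.
  have hc : Continuous fun t : ℝ => max K 0 * ((1 - t) * (1 - t) * σ) := by fun_prop
  have ht : Tendsto (fun t : ℝ => max K 0 * ((1 - t) * (1 - t) * σ)) (𝓝[<] 1) (𝓝 0) := by
    simpa using (hc.tendsto 1).mono_left nhdsWithin_le_nhds
  obtain ⟨t, ht1, ht2⟩ := ((ht.eventually_lt_const hε).and
    (Ioo_mem_nhdsLT (show (1 / 2 : ℝ) < 1 by norm_num))).exists
  have hmem : ((t, t) : ℝ × ℝ) ∈ ((maximalExtension m e).restrict D).Q := by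
    have h := hdiag t (by linarith [ht2.1]) ht2.2
    exact ⟨⟨0, Or.inl (hD h)⟩, h⟩
  obtain ⟨y⟩ : Nonempty S2 := (NormedSpace.sphere_nonempty.2 zero_le_one).to_subtype
  refine ⟨(⟨(t, t), hmem⟩, y), (hK _ ht2.1.le ht2.1.le).trans_lt ?_⟩
  have hσ : (volume : Measure E3).toSphere univ = ENNReal.ofReal σ :=
    (ENNReal.ofReal_toReal (measure_ne_top _ _)).symm
  have h1 : 0 ≤ 1 - t := by linarith [ht2.2]
  rw [hσ, ← ENNReal.ofReal_mul (by positivity)]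
  calc _ ≤ ENNReal.ofReal (max K 0) * ENNReal.ofReal ((1 - t) * (1 - t) * σ) := by
        gcongr
        exact le_max_left _ _
    _ = ENNReal.ofReal (max K 0 * ((1 - t) * (1 - t) * σ)) :=
        (ENNReal.ofReal_mul (le_max_right _ _)).symm
    _ < _ := (ENNReal.ofReal_lt_ofReal_iff hε).2 ht1

/-! ### Timelike curves in the maximal analytic extension -/

theorem convex_square (k : ℤ) : Convex ℝ (square k) := by
  rw [square_eq]
  exact (convex_Ioo _ _).prod (convex_Ioo _ _)

theorem square_subset (n : ℤ) : square (2 * n) ⊆ (maximalExtension m e).Q :=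
  fun _ hx => ⟨n, Or.inl hx⟩

theorem timelikeCurve_of_segment (he : 0 < |e|) (hem : |e| < m)
    {p q : (maximalExtension m e).Event} (hy : p.2 = q.2)
    (hu : (p.1 : ℝ × ℝ).1 < (q.1 : ℝ × ℝ).1) (hv : (p.1 : ℝ × ℝ).2 < (q.1 : ℝ × ℝ).2)
    (h : ∀ s ∈ Icc (0 : ℝ) 1,
      (p.1 + s • (q.1 - p.1 : ℝ × ℝ) : ℝ × ℝ) ∈ (maximalExtension m e).Q) :
    (maximalExtension m e).TimelikeCurve p q := by
  refine DoubleNull.timelikeCurve_of_segment hu hv (y := fun _ => p.2) contDiffOn_const rfl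
    (by rw [hy]) fun s hs => ⟨h s hs, p.2.2, ?_⟩
  have h1 : 0 < (maximalExtension m e).F _ := coeff_pos he hem (h s hs)
  have h2 := mul_pos h1 (mul_pos (sub_pos.2 hu) (sub_pos.2 hv))
  simpa using h2

theorem timelikeCurve_of_mem_square (he : 0 < |e|) (hem : |e| < m) {n : ℤ}
    {p q : (maximalExtension m e).Event} (hy : p.2 = q.2)
    (hp : (p.1 : ℝ × ℝ) ∈ square (2 * n)) (hq : (q.1 : ℝ × ℝ) ∈ square (2 * n))
    (hu : (p.1 : ℝ × ℝ).1 < (q.1 : ℝ × ℝ).1) (hv : (p.1 : ℝ × ℝ).2 < (q.1 : ℝ × ℝ).2) :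
    (maximalExtension m e).TimelikeCurve p q :=
  timelikeCurve_of_segment he hem hy hu hv fun _ hs =>
    square_subset n ((convex_square _).add_smul_sub_mem hp hq hs)

/-- A diagonal point lies in an even square or is the centre of a chart at `r₋`, where `U V = 0` is
above the singular value. -/
theorem diag_mem (he : 0 < |e|) (hem : |e| < m) (t : ℝ) :
    ((t, t) : ℝ × ℝ) ∈ (maximalExtension m e).Q := by
  have h1 := Int.floor_le (t / 2)
  have h2 := Int.lt_floor_add_one (t / 2)
  set n := ⌊t / 2⌋
  rcases lt_trichotomy t (2 * n + 1) with h | h | h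
  · have : |t - (2 * n : ℤ)| < 1 := by push_cast; rw [abs_lt]; constructor <;> linarith
    exact square_subset n ⟨this, this⟩
  · refine ⟨n, Or.inr ⟨?_, ?_⟩⟩
    · have : |t - (2 * n + 1 : ℤ)| < 1 := by push_cast; rw [h]; simp
      exact ⟨this, this⟩
    · simpa [innerProd, h] using innerUV_zero_neg he hem
  · have : |t - (2 * (n + 1) : ℤ)| < 1 := by push_cast; rw [abs_lt]; constructor <;> linarith
    exact square_subset (n + 1) ⟨this, this⟩

theorem timelikeCurve_diag (he : 0 < |e|) (hem : |e| < m) {t t' : ℝ} (h : t < t') (y : S2) :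
    (maximalExtension m e).TimelikeCurve (⟨(t, t), diag_mem he hem t⟩, y)
      (⟨(t', t'), diag_mem he hem t'⟩, y) := by
  refine timelikeCurve_of_segment he hem rfl h h fun s _ => ?_
  simpa using diag_mem he hem (t + s * (t' - t))

/-- A route around the singularity `U V = c`. With `V ≥ 0`, raising a negative `U` raises the
product, and once `U ≥ 0` the product is nonnegative; so `U` may increase freely if `V` increases
only slightly. Continuity in `V` at the starting point provides the room. -/
theorem exists_lt_kruskal_mul {a c : ℝ} (ha : 0 < a) (hc : c < 0) {w₁ w₂ : ℝ}
    (h1 : w₁ ∈ Ioc (-1) 0) (h2 : w₂ ∈ Ico 0 1) (h : c < kruskal a w₁ * kruskal a w₂) :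
    ∃ w₃ ∈ Ioo w₂ 1, ∀ w ∈ Ico w₁ 1, ∀ w' ∈ Icc w₂ w₃, c < kruskal a w * kruskal a w' := by
  have hmono := (strictMonoOn_kruskal ha).monotoneOn
  have hcont : ContinuousAt (fun w => kruskal a w₁ * kruskal a w) w₂ :=
    ((hasDerivAt_kruskal a (abs_lt.2 ⟨by linarith [h2.1], h2.2⟩)).continuousAt).const_mul _
  have hev : ∀ᶠ w in 𝓝[>] w₂, c < kruskal a w₁ * kruskal a w :=
    (hcont.eventually_const_lt h).filter_mono nhdsWithin_le_nhds
  obtain ⟨w₃, hw₃, hI⟩ := (hev.and (Ioo_mem_nhdsGT h2.2)).exists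
  refine ⟨w₃, hI, fun w hw w' hw' => ?_⟩
  have hw1 : w ∈ Ioo (-1 : ℝ) 1 := ⟨h1.1.trans_le hw.1, hw.2⟩
  have hw2 : w' ∈ Ioo (-1 : ℝ) 1 := ⟨by linarith [h2.1, hw'.1], hw'.2.trans_lt hI.2⟩
  have hk' : 0 ≤ kruskal a w' := by
    simpa using hmono (by simp) hw2 (h2.1.trans hw'.1)
  rcases le_or_gt 0 w with h0 | h0
  · have hk : 0 ≤ kruskal a w := by simpa using hmono (by simp) hw1 h0
    exact hc.trans_le (mul_nonneg hk hk')
  · have hk : kruskal a w ≤ 0 := ((kruskal_neg_iff ha (abs_lt.2 hw1)).2 h0).le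
    have hk1 : kruskal a w₁ ≤ kruskal a w := hmono ⟨h1.1, by linarith [h1.2]⟩ hw1 hw.1
    have hk3 : kruskal a w' ≤ kruskal a w₃ := hmono hw2 ⟨by linarith [h2.1, hI.1], hI.2⟩ hw'.2
    refine hw₃.trans_le ?_
    nlinarith

theorem add_mul_sub_mem_Icc {a b s : ℝ} (h : a ≤ b) (hs : s ∈ Icc (0 : ℝ) 1) :
    a + s * (b - a) ∈ Icc a b := by
  constructor
  · nlinarith [hs.1]
  · nlinarith [hs.2]

theorem eventually_diag_mem_chronFuture_of_mem_square (he : 0 < |e|) (hem : |e| < m) {n : ℤ}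
    (p : (maximalExtension m e).Event) (hp : (p.1 : ℝ × ℝ) ∈ square (2 * n)) :
    ∀ᶠ t in atTop, ((⟨(t, t), diag_mem he hem t⟩, p.2) : (maximalExtension m e).Event) ∈
      (maximalExtension m e).chronFuture p := by
  have h1 := abs_lt.1 hp.1
  have h2 := abs_lt.1 hp.2
  -- The midpoint between the larger coordinate of `p` and the future corner of the square.
  set t₀ := (max (p.1 : ℝ × ℝ).1 (p.1 : ℝ × ℝ).2 + ((2 * n : ℤ) + 1)) / 2 with ht₀
  have hM := le_max_left (p.1 : ℝ × ℝ).1 (p.1 : ℝ × ℝ).2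
  have hM' := le_max_right (p.1 : ℝ × ℝ).1 (p.1 : ℝ × ℝ).2
  have hlt : max (p.1 : ℝ × ℝ).1 (p.1 : ℝ × ℝ).2 < (2 * n : ℤ) + 1 :=
    max_lt (by linarith) (by linarith)
  have hsq : |t₀ - (2 * n : ℤ)| < 1 := abs_lt.2 ⟨by linarith, by linarith⟩
  filter_upwards [eventually_gt_atTop t₀] with t ht
  refine Relation.TransGen.head (b := (⟨(t₀, t₀), diag_mem he hem t₀⟩, p.2)) ?_
    (.single (timelikeCurve_diag he hem ht p.2))
  exact timelikeCurve_of_mem_square he hem rfl hp ⟨hsq, hsq⟩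
    (show _ < t₀ by linarith) (show _ < t₀ by linarith)

theorem eventually_diag_mem_chronFuture (he : 0 < |e|) (hem : |e| < m)
    (p : (maximalExtension m e).Event) :
    ∀ᶠ t in atTop, ((⟨(t, t), diag_mem he hem t⟩, p.2) : (maximalExtension m e).Event) ∈
      (maximalExtension m e).chronFuture p := by
  have hb : 0 < kMinus m e / kPlus m e := div_pos (kMinus_pos he hem) (kPlus_pos he hem)
  have hc := innerUV_zero_neg he hem
  obtain ⟨n, hn | ⟨hn, hin⟩⟩ := p.1.2
  · exact eventually_diag_mem_chronFuture_of_mem_square he hem p hn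
  -- From a point of the chart that lies in the past of the next chart, go to that chart.
  have key : ∀ x' : ℝ × ℝ, x' ∈ square (2 * (n + 1)) → (p.1 : ℝ × ℝ).1 < x'.1 →
      (p.1 : ℝ × ℝ).2 < x'.2 →
      (∀ s ∈ Icc (0 : ℝ) 1, (p.1 + s • (x' - p.1) : ℝ × ℝ) ∈ innerChart m e (2 * n + 1)) →
      ∀ᶠ t in atTop, ((⟨(t, t), diag_mem he hem t⟩, p.2) : (maximalExtension m e).Event) ∈
        (maximalExtension m e).chronFuture p := by
    intro x' hx' h1 h2 h3
    filter_upwards [eventually_diag_mem_chronFuture_of_mem_square he hem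
      (⟨x', square_subset _ hx'⟩, p.2) hx'] with t ht
    exact Relation.TransGen.head (timelikeCurve_of_segment he hem
      (q := (⟨x', square_subset _ hx'⟩, p.2)) rfl h1 h2 fun s hs => ⟨n, Or.inr (h3 s hs)⟩) ht
  have h1 := abs_lt.1 hn.1
  have h2 := abs_lt.1 hn.2
  push_cast at h1 h2
  rw [innerProd] at hin
  by_cases hpast : (p.1 : ℝ × ℝ).1 < 2 * n + 1 ∧ (p.1 : ℝ × ℝ).2 < 2 * n + 1
  · refine eventually_diag_mem_chronFuture_of_mem_square he hem (n := n) p ⟨?_, ?_⟩ <;>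
      push_cast <;> rw [abs_lt] <;> constructor <;> linarith
  by_cases hfut : 2 * n + 1 < (p.1 : ℝ × ℝ).1 ∧ 2 * n + 1 < (p.1 : ℝ × ℝ).2
  · refine eventually_diag_mem_chronFuture_of_mem_square he hem (n := n + 1) p ⟨?_, ?_⟩ <;>
      push_cast <;> rw [abs_lt] <;> constructor <;> linarith
  -- What remains is a point with `U V ≤ 0`, on either side between the horizon and the singularity.
  have hcases : ((p.1 : ℝ × ℝ).1 ≤ 2 * n + 1 ∧ 2 * n + 1 ≤ (p.1 : ℝ × ℝ).2) ∨
      (2 * n + 1 ≤ (p.1 : ℝ × ℝ).1 ∧ (p.1 : ℝ × ℝ).2 ≤ 2 * n + 1) := by grind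
  rcases hcases with ⟨hu, hv⟩ | ⟨hu, hv⟩
  · obtain ⟨w, hw, hlt⟩ := exists_lt_kruskal_mul hb hc (w₁ := (p.1 : ℝ × ℝ).1 - (2 * n + 1 : ℤ))
      (w₂ := (p.1 : ℝ × ℝ).2 - (2 * n + 1 : ℤ))
      ⟨by push_cast; linarith, by push_cast; linarith⟩
      ⟨by push_cast; linarith, by push_cast; linarith⟩ hin
    obtain ⟨hw1, hw2⟩ := hw
    push_cast at hw1
    -- The target lies in the future quadrant of the chart; the segment stays in the rectangle
    -- controlled by `hlt`.
    refine key ((2 * n + 1 : ℤ) + 1 / 2, (2 * n + 1 : ℤ) + w) ⟨?_, ?_⟩ ?_ ?_ fun s hs => ?_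
    · push_cast; rw [abs_lt]; constructor <;> linarith
    · push_cast; rw [abs_lt]; constructor <;> linarith
    · push_cast; linarith
    · push_cast; linarith
    · have e1 := add_mul_sub_mem_Icc (a := (p.1 : ℝ × ℝ).1) (b := (2 * n + 1 : ℤ) + 1 / 2)
        (by push_cast; linarith) hs
      have e2 := add_mul_sub_mem_Icc (a := (p.1 : ℝ × ℝ).2) (b := (2 * n + 1 : ℤ) + w)
        (by push_cast; linarith) hs
      obtain ⟨e3, e4⟩ := e1
      obtain ⟨e5, e6⟩ := e2
      refine ⟨⟨?_, ?_⟩, hlt _ ⟨?_, ?_⟩ _ ⟨?_, ?_⟩⟩ <;>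
        simp only [Prod.fst_add, Prod.snd_add, Prod.smul_fst, Prod.smul_snd, Prod.fst_sub,
          Prod.snd_sub, smul_eq_mul, abs_lt] <;> push_cast at * <;>
        first | linarith | (constructor <;> linarith)
  · obtain ⟨w, hw, hlt⟩ := exists_lt_kruskal_mul hb hc (w₁ := (p.1 : ℝ × ℝ).2 - (2 * n + 1 : ℤ))
      (w₂ := (p.1 : ℝ × ℝ).1 - (2 * n + 1 : ℤ))
      ⟨by push_cast; linarith, by push_cast; linarith⟩
      ⟨by push_cast; linarith, by push_cast; linarith⟩ (by rwa [mul_comm])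
    obtain ⟨hw1, hw2⟩ := hw
    push_cast at hw1
    refine key ((2 * n + 1 : ℤ) + w, (2 * n + 1 : ℤ) + 1 / 2) ⟨?_, ?_⟩ ?_ ?_ fun s hs => ?_
    · push_cast; rw [abs_lt]; constructor <;> linarith
    · push_cast; rw [abs_lt]; constructor <;> linarith
    · push_cast; linarith
    · push_cast; linarith
    · have e1 := add_mul_sub_mem_Icc (a := (p.1 : ℝ × ℝ).2) (b := (2 * n + 1 : ℤ) + 1 / 2)
        (by push_cast; linarith) hs
      have e2 := add_mul_sub_mem_Icc (a := (p.1 : ℝ × ℝ).1) (b := (2 * n + 1 : ℤ) + w)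
        (by push_cast; linarith) hs
      obtain ⟨e3, e4⟩ := e1
      obtain ⟨e5, e6⟩ := e2
      refine ⟨⟨?_, ?_⟩, (hlt _ ⟨?_, ?_⟩ _ ⟨?_, ?_⟩).trans_eq (mul_comm _ _)⟩ <;>
        simp only [Prod.fst_add, Prod.snd_add, Prod.smul_fst, Prod.smul_snd, Prod.fst_sub,
          Prod.snd_sub, smul_eq_mul, abs_lt] <;> push_cast at * <;>
        first | linarith | (constructor <;> linarith)

/-- Along this compact diagonal segment `r` is at most `r₊` and bounded away from `r₋`, so `F` has a
positive lower bound and some angular speed is affordable. An open set of directions is needed for a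
future of positive volume. -/
theorem exists_timelikeCurve_rotation (he : 0 < |e|) (hem : |e| < m) (n : ℤ) (y₀ : S2) :
    ∃ η > 0, ∀ z : S2, dist z y₀ < η → (maximalExtension m e).TimelikeCurve
      (⟨(2 * n, 2 * n), diag_mem he hem _⟩, y₀)
      (⟨(2 * n + 1 / 2, 2 * n + 1 / 2), diag_mem he hem _⟩, z) := by
  have ha : 0 < kPlus m e / kMinus m e := div_pos (kPlus_pos he hem) (kMinus_pos he hem)
  have hrp : 0 < rPlus m e := (rMinus_pos he hem).trans (rMinus_lt_rPlus hem)
  obtain ⟨δ, hδ, hδle⟩ := exists_add_le_of_outerUV_le he hem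
    (kruskal (kPlus m e / kMinus m e) (1 / 2) ^ 2)
  have hF := fun {r} => le_outerF (r := r) he hem hδ
  set a := kPlus m e / kMinus m e with ha_def
  set F₀ := δ ^ (1 + a) * Real.exp (-(2 * kPlus m e * rPlus m e)) /
    (kPlus m e ^ 2 * rPlus m e ^ 2) with hF₀
  have hF₀p : 0 < F₀ := by have := kPlus_pos he hem; positivity
  set d := Real.pi / 2 * min 1 a with hd
  have hdp : 0 < d := by have := Real.pi_pos; have := lt_min one_pos ha; positivity
  -- The speed at which `r₊² |y'|²` equals the lower bound `F₀ d²` times `du dv = 1/2 * 1/2`.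
  obtain ⟨η, hη, hpath⟩ := exists_sphere_path y₀
    (ε := √(F₀ * d * d / 4) / rPlus m e) (by positivity)
  refine ⟨η, hη, fun z hz => ?_⟩
  obtain ⟨y, hy, hy0, hy1, hys⟩ := hpath z hz
  refine DoubleNull.timelikeCurve_of_segment (by simp) (by simp) hy hy0 hy1 fun s hs => ?_
  obtain ⟨h1, h2⟩ := hys s hs
  have hpt : ((2 * n : ℝ), (2 * n : ℝ)) +
      s • (((2 * n + 1 / 2 : ℝ), (2 * n + 1 / 2 : ℝ)) - ((2 * n : ℝ), (2 * n : ℝ))) =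
      (2 * n + s / 2, 2 * n + s / 2) := by
    ext <;> simp <;> ring
  simp only [hpt]
  refine ⟨diag_mem he hem _, h1, ?_⟩
  have hs2 : |s / 2| < 1 := abs_lt.2 ⟨by linarith [hs.1], by linarith [hs.2]⟩
  have hsq : ((2 * n + s / 2, 2 * n + s / 2) : ℝ × ℝ) ∈ square (2 * n) := by
    constructor <;> simpa using hs2
  have hsub : 2 * (n : ℝ) + s / 2 - (2 * n : ℤ) = s / 2 := by push_cast; ring
  change radius m e _ ^ 2 * _ < coeff m e _ * _
  rw [radius_of_mem_square hsq, coeff_of_mem_square hsq, outerProd, ← ha_def]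
  simp only [hsub]
  have hmono := (strictMonoOn_kruskal ha).monotoneOn
  have hk0 : 0 ≤ kruskal a (s / 2) := by
    simpa using hmono (by simp) (abs_lt.1 hs2) (show 0 ≤ s / 2 by linarith [hs.1])
  have hk1 : kruskal a (s / 2) ≤ kruskal a (1 / 2) :=
    hmono (abs_lt.1 hs2) (by norm_num) (by linarith [hs.2])
  obtain ⟨hr1, hr2⟩ := outerR_spec he hem (kruskal a (s / 2) * kruskal a (s / 2))
  set r := outerR m e (kruskal a (s / 2) * kruskal a (s / 2))
  have hr3 : rMinus m e + δ ≤ r := hδle r hr1 (by rw [hr2]; nlinarith)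
  have hr4 : r ≤ rPlus m e := by
    by_contra! h
    have := (outerUV_neg_iff hr1).2 h
    rw [hr2] at this
    nlinarith
  have hr0 : 0 < r := (rMinus_pos he hem).trans hr1
  have hd1 := le_deriv_kruskal ha hs2
  rw [← hd] at hd1
  have hF1 := hF hr3 hr4
  have hFp := outerF_pos he hem hr1
  have hd1p := deriv_kruskal_pos ha hs2
  calc r ^ 2 * ‖derivWithin y (Icc 0 1) s‖ ^ 2
      ≤ rPlus m e ^ 2 * ‖derivWithin y (Icc 0 1) s‖ ^ 2 := by gcongr
    _ < rPlus m e ^ 2 * (√(F₀ * d * d / 4) / rPlus m e) ^ 2 := by gcongr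
    _ = F₀ * d * d * (1 / 2 * (1 / 2)) := by
        rw [div_pow, Real.sq_sqrt (by positivity)]
        field_simp
        norm_num
    _ ≤ outerF m e r * deriv (kruskal a) (s / 2) * deriv (kruskal a) (s / 2) *
          (1 / 2 * (1 / 2)) := by gcongr
    _ = _ := by ring

/-! ### The volume of an exterior region -/

/-- The rectangle has width `1/4` in `u` and `δ` in `v`, so a density of `K / δ` gives it a volume
proportional to `K`, whatever `δ` is. -/
theorem exists_le_density (he : 0 < |e|) (hem : |e| < m) (n : ℤ) {K : ℝ} (hK : 0 < K) :
    ∃ δ ∈ Ioo (0 : ℝ) (1 / 2), ∀ x ∈ Ioo (2 * n - 1 / 2 : ℝ) (2 * n - 1 / 4) ×ˢ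
      Ioo (2 * n + 1 - δ : ℝ) (2 * n + 1), K / δ ≤ coeff m e x / 2 * radius m e x ^ 2 := by
  have hk := kPlus_pos he hem
  have ha : 0 < kPlus m e / kMinus m e := div_pos hk (kMinus_pos he hem)
  have hlt := rMinus_lt_rPlus hem
  have hpi := Real.pi_pos
  set a := kPlus m e / kMinus m e with ha_def
  set d := Real.pi / 2 * min 1 a with hd
  have hmin := lt_min one_pos ha
  have hdp : 0 < d := by positivity
  have hmono := (strictMonoOn_kruskal ha).monotoneOn
  set k₁ := -kruskal a (-1 / 2) with hk₁
  have hk₁p : 0 < k₁ := neg_pos.2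
    ((kruskal_neg_iff ha (by rw [abs_lt]; constructor <;> norm_num)).2 (by norm_num))
  have hk₂ : kruskal a (-1 / 4) < 0 :=
    (kruskal_neg_iff ha (by rw [abs_lt]; constructor <;> norm_num)).2 (by norm_num)
  -- Collects the constants of the final estimate; it suffices that `(r - r₊)(r - r₋) ≥ K / c`,
  -- which the next choice of `X` ensures.
  set c := d * min 1 a / (2 * kPlus m e ^ 2 * k₁) with hc
  have hcp : 0 < c := by positivity
  obtain ⟨X, hX⟩ := exists_lt_of_outerUV_lt hem (rPlus m e + √(K / c))
  -- Since `U ≤ kruskal a (-1/4) < 0` on the strip, this lower bound for `V` gives `U V < X`.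
  have hev := (tendsto_kruskal ha).eventually_gt_atTop (X / kruskal a (-1 / 4))
  obtain ⟨b, hb, hI⟩ := mem_nhdsLT_iff_exists_Ioo_subset.1
    (inter_mem hev (Ioo_mem_nhdsLT (show (3 / 4 : ℝ) < 1 by norm_num)))
  have hb' : b < 1 := hb
  have hδ1 : 0 < min (1 - b) (1 / 4) := lt_min (by linarith) (by norm_num)
  refine ⟨min (1 - b) (1 / 4), ⟨hδ1, (min_le_right _ _).trans_lt (by norm_num)⟩,
    fun x hx => ?_⟩
  have hδb := min_le_left (1 - b) (1 / 4)
  have hδ4 := min_le_right (1 - b) (1 / 4)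
  set δ := min (1 - b) (1 / 4)
  obtain ⟨⟨hx1, hx2⟩, hx3, hx4⟩ := hx
  have hsq : x ∈ square (2 * n) := by
    constructor <;> push_cast <;> rw [abs_lt] <;> constructor <;> linarith
  rw [coeff_of_mem_square hsq, radius_of_mem_square hsq, outerProd, ← ha_def]
  have hw1 := hsq.1
  have hw2 := hsq.2
  have hw3 : x.1 - (2 * n : ℤ) ∈ Ioo (-1 / 2 : ℝ) (-1 / 4) := by
    push_cast; constructor <;> linarith
  have hw4 : x.2 - (2 * n : ℤ) ∈ Ioo (1 - δ) 1 := by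
    push_cast; constructor <;> linarith
  set w₁ := x.1 - (2 * n : ℤ)
  set w₂ := x.2 - (2 * n : ℤ)
  have h2 : X / kruskal a (-1 / 4) < kruskal a w₂ := (hI ⟨by linarith [hw4.1], hw4.2⟩).1
  have hV : 0 < kruskal a w₂ := (kruskal_pos_iff ha hw2).2 (by linarith [hw4.1])
  have hU : kruskal a w₁ < 0 := (kruskal_neg_iff ha hw1).2 (by linarith [hw3.2])
  have hU1 : kruskal a w₁ ≤ kruskal a (-1 / 4) :=
    hmono (abs_lt.1 hw1) (by norm_num) hw3.2.le
  have hU2 : -kruskal a w₁ ≤ k₁ := neg_le_neg (hmono (by norm_num) (abs_lt.1 hw1) hw3.1.le)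
  obtain ⟨hr1, hr2⟩ := outerR_spec he hem (kruskal a w₁ * kruskal a w₂)
  set r := outerR m e (kruskal a w₁ * kruskal a w₂)
  have hr3 : rPlus m e + √(K / c) < r := by
    refine hX r hr1 ?_
    rw [hr2]
    rw [div_lt_iff_of_neg hk₂] at h2
    nlinarith
  have hF := outerF_mul_sq he hem hr1
  rw [hr2] at hF
  have hs := Real.sqrt_nonneg (K / c)
  have hKc : K / c ≤ (r - rPlus m e) * (r - rMinus m e) := by
    calc K / c = √(K / c) * √(K / c) := (Real.mul_self_sqrt (by positivity)).symm
      _ ≤ _ := by gcongr <;> linarith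
  have hd1 := le_deriv_kruskal ha hw1
  have hd1p := deriv_kruskal_pos ha hw1
  have hd2 := mul_kruskal_le_deriv ha (show 0 < w₂ by linarith [hw4.1]) hw4.2
  have hFp := outerF_pos he hem hr1
  have hr0 : 0 < r := (rMinus_pos he hem).trans hr1
  have h1w : 0 < 1 - w₂ := by linarith [hw4.2]
  have hFV : K / c / (kPlus m e ^ 2 * k₁) ≤ outerF m e r * r ^ 2 * kruskal a w₂ := by
    have e1 : (outerF m e r * r ^ 2 * kruskal a w₂) * -kruskal a w₁ * kPlus m e ^ 2 =
        (r - rPlus m e) * (r - rMinus m e) := by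
      field_simp at hF
      linear_combination -hF
    rw [div_le_iff₀ (by positivity)]
    calc K / c ≤ (outerF m e r * r ^ 2 * kruskal a w₂) * -kruskal a w₁ * kPlus m e ^ 2 := by
          rw [e1]; exact hKc
      _ ≤ (outerF m e r * r ^ 2 * kruskal a w₂) * k₁ * kPlus m e ^ 2 := by gcongr
      _ = _ := by ring
  calc K / δ = K / c / (kPlus m e ^ 2 * k₁) * d * (min 1 a / δ) / 2 := by
        rw [hc]; field_simp
    _ ≤ outerF m e r * r ^ 2 * kruskal a w₂ * deriv (kruskal a) w₁ * (min 1 a / (1 - w₂)) / 2 := by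
        gcongr
        linarith [hw4.1]
    _ = outerF m e r * r ^ 2 * deriv (kruskal a) w₁ *
        (min 1 a / (1 - w₂) * kruskal a w₂) / 2 := by ring
    _ ≤ outerF m e r * r ^ 2 * deriv (kruskal a) w₁ * deriv (kruskal a) w₂ / 2 := by
        gcongr
    _ = _ := by ring

theorem vol_chronFuture_eq_top (he : 0 < |e|) (hem : |e| < m)
    (p : (maximalExtension m e).Event) :
    (maximalExtension m e).vol ((maximalExtension m e).chronFuture p) = ⊤ := by
  obtain ⟨t₀, ht₀⟩ := eventually_atTop.1 (eventually_diag_mem_chronFuture he hem p)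
  obtain ⟨n, hn⟩ : ∃ n : ℤ, t₀ ≤ 2 * n :=
    ⟨⌈t₀ / 2⌉, by linarith [Int.le_ceil (t₀ / 2)]⟩
  obtain ⟨η, hη, hrot⟩ := exists_timelikeCurve_rotation he hem n p.2
  have hmem : ∀ x : (maximalExtension m e).Event, (x.1 : ℝ × ℝ) ∈ square (2 * (n + 1)) →
      2 * n + 3 / 2 < (x.1 : ℝ × ℝ).1 → 2 * n + 3 / 2 < (x.1 : ℝ × ℝ).2 →
      x.2 ∈ ball p.2 η → x ∈ (maximalExtension m e).chronFuture p := by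
    intro x hx h1 h2 hz
    refine (((ht₀ _ hn).tail (hrot x.2 hz)).tail (timelikeCurve_diag he hem
      (t' := 2 * n + 3 / 2) (by linarith) x.2)).tail ?_
    refine timelikeCurve_of_mem_square he hem rfl ?_ hx h1 h2
    constructor <;> push_cast <;> rw [abs_lt] <;> constructor <;> linarith
  set σ := ((volume : Measure E3).toSphere (ball p.2 η)).toReal with hσ
  have hσ' : (volume : Measure E3).toSphere (ball p.2 η) = ENNReal.ofReal σ :=
    (ENNReal.ofReal_toReal (measure_ne_top _ _)).symm
  have hσp : 0 < σ := ENNReal.toReal_pos (measure_ball_pos _ _ hη).ne' (measure_ne_top _ _)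
  refine ENNReal.eq_top_of_forall_nnreal_le fun K => ?_
  -- The strip has area `δ / 4` and solid angle `σ`, so its volume is at least `K + 1`; the added
  -- `1` keeps the constant positive when `K = 0`.
  obtain ⟨δ, ⟨hδ0, hδ1⟩, hδ⟩ := exists_le_density he hem (n + 1)
    (K := 4 * (K + 1) / σ) (by positivity)
  push_cast at hδ
  have hAsq : Ioo (2 * (n + 1) - 1 / 2 : ℝ) (2 * (n + 1) - 1 / 4) ×ˢ
      Ioo (2 * (n + 1) + 1 - δ : ℝ) (2 * (n + 1) + 1) ⊆ square (2 * (n + 1)) := by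
    rintro x ⟨⟨h1, h2⟩, h3, h4⟩
    constructor <;> push_cast <;> rw [abs_lt] <;> constructor <;> linarith
  refine le_trans ?_ (DoubleNull.le_vol measurableSet_maximalExtension
    (measurableSet_Ioo.prod measurableSet_Ioo) (hAsq.trans (square_subset _))
    (B := ball p.2 η) measurableSet_ball (fun x hx hz => ?_) hδ)
  · rw [Measure.volume_eq_prod, Measure.prod_prod, Real.volume_Ioo, Real.volume_Ioo, hσ',
      ← ENNReal.ofReal_mul (by linarith), ← ENNReal.ofReal_mul (by ring_nf; positivity),
      ← ENNReal.ofReal_mul (by positivity)]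
    have e1 : 4 * (K + 1) / σ / δ * ((2 * (n + 1) - 1 / 4 - (2 * (n + 1) - 1 / 2)) *
        (2 * (n + 1) + 1 - (2 * (n + 1) + 1 - δ)) * σ) = (K + 1 : ℝ) := by
      field_simp
      ring
    rw [e1, ← ENNReal.ofReal_coe_nnreal]
    exact ENNReal.ofReal_le_ofReal (by linarith)
  · exact hmem x (hAsq hx) (by linarith [hx.1.1]) (by linarith [hx.2.1]) hz

end RN

end

theorem mainTheorem7 (m e : ℝ) (he : 0 < |e|) (hem : |e| < m) :
    -- the region `{r > r₋}`, with one asymptotic end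
    (FutureVolumeIncomplete (RN.oneEndedRegion m e).chronFuture (RN.oneEndedRegion m e).vol ∧
      ∀ p : (RN.oneEndedRegion m e).Event,
        RN.rMinus m e < (RN.oneEndedRegion m e).r p.1 →
        (RN.oneEndedRegion m e).r p.1 < RN.rPlus m e →
        (RN.oneEndedRegion m e).vol ((RN.oneEndedRegion m e).chronFuture p) < ⊤) ∧
    -- the region `{r > r₋}`, with two asymptotic ends; `0 < u` excludes the white-hole region
    (FutureVolumeIncomplete (RN.twoEndedRegion m e).chronFuture (RN.twoEndedRegion m e).vol ∧
      ∀ p : (RN.twoEndedRegion m e).Event,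
        RN.rMinus m e < (RN.twoEndedRegion m e).r p.1 →
        (RN.twoEndedRegion m e).r p.1 < RN.rPlus m e →
        0 < (p.1 : ℝ × ℝ).1 →
        (RN.twoEndedRegion m e).vol ((RN.twoEndedRegion m e).chronFuture p) < ⊤) ∧
    -- the maximal analytic extension
    (FutureVolumeComplete (RN.maximalExtension m e).chronFuture (RN.maximalExtension m e).vol ∧
      ∀ p : (RN.maximalExtension m e).Event,
        (RN.maximalExtension m e).vol ((RN.maximalExtension m e).chronFuture p) = ⊤) := by
  have hsub1 : {x | RN.rMinus m e < RN.radius m e x ∧ x ∈ RN.square 0 ∧ 0 < x.2} ⊆ RN.square 0 :=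
    fun _ hx => hx.2.1
  have hsub2 : {x | RN.rMinus m e < RN.radius m e x ∧ x ∈ RN.square 0} ⊆ RN.square 0 :=
    fun _ hx => hx.2
  have hdiag : ∀ t : ℝ, 0 < t → t < 1 → (t, t) ∈ RN.square 0 := fun t h0 h1 => by
    have : |t - (0 : ℤ)| < 1 := by rw [Int.cast_zero, sub_zero, abs_of_pos h0]; exact h1
    exact ⟨this, this⟩
  refine ⟨⟨?_, fun p _ hr => ?_⟩, ⟨?_, fun p _ hr hu => ?_⟩, fun h => ?_, ?_⟩
  · exact RN.futureVolumeIncomplete_restrict he hem hsub1 fun t h0 h1 =>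
      ⟨RN.rMinus_lt_radius he hem (hdiag t h0 h1), hdiag t h0 h1, h0⟩
  -- In the one-ended region `0 < v` by definition, which rules out the white-hole quadrant.
  · have hv := p.1.2.2.2.2
    rcases RN.pos_or_neg_of_radius_lt he hem p.1.2.2.2.1 hr with h | h
    · exact RN.vol_chronFuture_lt_top he hem hsub1 p h.1 h.2
    · exact absurd h.2 hv.not_gt
  · exact RN.futureVolumeIncomplete_restrict he hem hsub2 fun t h0 h1 =>
      ⟨RN.rMinus_lt_radius he hem (hdiag t h0 h1), hdiag t h0 h1⟩
  · rcases RN.pos_or_neg_of_radius_lt he hem p.1.2.2.2 hr with h | h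
    · exact RN.vol_chronFuture_lt_top he hem hsub2 p h.1 h.2
    · exact absurd h.1 hu.not_gt
  · obtain ⟨x, hx⟩ := h 1 one_pos
    rw [RN.vol_chronFuture_eq_top he hem x] at hx
    exact not_top_lt hx
  · exact RN.vol_chronFuture_eq_top he hem
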